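/- Let $1\le n_J\le n_F\le N$. Consider $N$ parallel unit-speed FCFS servers. Jobs arrive according to a renewal process whose interarrival times are distributed as $A\ge 0$ with $0<\mathbb{E}[A]<\infty$. Each job has $n_F$ replicas, which are assigned to $n_F$ distinct servers chosen uniformly at random without replacement. The vectors of nonnegative replica sizes $(B_1,\dots,B_{n_F})$ of the jobs are i.i.d. with an arbitrary joint law with identical marginals, and interarrival times, replica sizes and assignments are independent. As soon as $n_J$ of its replicas have completed service, the job is complete and its other replicas are cancelled (cancel-on-completion fork-join$(n_F,n_J)$ model). Write $X_{(k)}$ for the $k$-th smallest of $X_1,\dots,X_{n_F}$. In steady state (that is, the law of the vector of workloads found by an arriving job is stationary), let $W_1,\dots,W_{n_F}$ be the waiting times of the replicas of a job at their servers, i.e. the workloads (times until the server is free of all replicas of earlier jobs) that the job finds there. Let $$K=\binom{N}{n_F}\frac{n_F!}{(n_F-n_J+1)!},\qquad \rho_U=\frac{\mathbb{E}[B_{(n_J)}]}{\mathbb{E}[A]},\qquad \rho_L=\frac{\mathbb{E}[B_{(n_J)}]}{K\,\mathbb{E}[A]},$$ and let $\bar B^{\mathrm{res}}_{(n_J)}(x)=\frac{1}{\mathbb{E}[B_{(n_J)}]}\int_x^\infty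 \mathbb{P}(B_{(n_J)}>y)\,dy$, $x\ge 0$, be the tail of the residual law of $B_{(n_J)}$. Suppose that $\mathbb{E}[B_{(n_J)}]<\infty$, that $\rho_U<1$, and that this residual law is subexponential, i.e. $\mathbb{P}(Y_1+Y_2>x)/\mathbb{P}(Y_1>x)\to 2$ as $x\to\infty$ for independent $Y_1,Y_2$ with this law. Then, as $x\to\infty$, $$(1+o(1))\,\frac{\rho_L}{1-\rho_L}\,\bar B^{\mathrm{res}}_{(n_J)}(x)\;\le\;\mathbb{P}\big(W_{(n_J)}>x\big)\;\le\;(1+o(1))\,\frac{\rho_U}{1-\rho_U}\,\bar B^{\mathrm{res}}_{(n_J)}(x).$$ -/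

import Mathlib

open MeasureTheory ProbabilityTheory Filter Topology
open scoped ENNReal Nat

namespace ForkJoin

noncomputable section

/-! ### Order statistics, tails, subexponential laws -/

/-- The `k`-th order statistic (`k`-th smallest value, `1 ≤ k ≤ n`) of `x 0, …, x (n-1)`:
the least `t` such that at least `k` of the values are at most `t`. -/
def orderStat {n : ℕ} (k : ℕ) (x : Fin n → ℝ) : ℝ :=
  sInf {t : ℝ | k ≤ (Finset.univ.filter fun i => x i ≤ t).card}

/-- For `1 ≤ k ≤ n` the infimum in `orderStat` is attained, so that `orderStat k x ≤ t` says
exactly that at least `k` of the values are at most `t`. -/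
theorem orderStat_le_iff {n k : ℕ} (hk : 1 ≤ k) (hkn : k ≤ n) (x : Fin n → ℝ) (t : ℝ) :
    orderStat k x ≤ t ↔ k ≤ (Finset.univ.filter fun i => x i ≤ t).card := by
  classical
  set S : Set ℝ := {t : ℝ | k ≤ (Finset.univ.filter fun i => x i ≤ t).card} with hS
  have hup : ∀ {s u : ℝ}, s ∈ S → s ≤ u → u ∈ S := by
    intro s u hs hsu
    refine le_trans (show k ≤ _ from hs) (Finset.card_le_card ?_)
    intro i hi
    simp only [Finset.mem_filter, Finset.mem_univ, true_and] at hi ⊢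
    exact hi.trans hsu
  have hpos : 0 < n := by omega
  have huniv : (Finset.univ : Finset (Fin n)).Nonempty := ⟨⟨0, hpos⟩, Finset.mem_univ _⟩
  have hne : S.Nonempty := by
    refine ⟨Finset.univ.sup' huniv x, ?_⟩
    have : (Finset.univ.filter fun i => x i ≤ Finset.univ.sup' huniv x) = Finset.univ := by
      ext i
      simp only [Finset.mem_filter, Finset.mem_univ, true_and, iff_true]
      exact Finset.le_sup' x (Finset.mem_univ i)
    show k ≤ _
    rw [this]
    simpa using hkn
  have hbdd : BddBelow S := by
    refine ⟨Finset.univ.inf' huniv x, ?_⟩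
    intro s hs
    have hc : 0 < (Finset.univ.filter fun i => x i ≤ s).card := lt_of_lt_of_le hk hs
    obtain ⟨i, hi⟩ := Finset.card_pos.mp hc
    simp only [Finset.mem_filter, Finset.mem_univ, true_and] at hi
    exact (Finset.inf'_le x (Finset.mem_univ i)).trans hi
  constructor
  · intro h
    by_contra hlt
    -- the finitely many values above `t` stay above some `u > t`
    have hev : ∀ i : Fin n, ∀ᶠ u in 𝓝[>] t, (x i ≤ u → x i ≤ t) := by
      intro i
      rcases le_or_gt (x i) t with hi | hi
      · exact Eventually.of_forall fun _ _ => hi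
      · filter_upwards [mem_nhdsWithin_of_mem_nhds (Iio_mem_nhds hi)] with u hu hxu
        exact absurd hxu (not_le.mpr hu)
    obtain ⟨u, hu, htu⟩ := ((eventually_all.mpr hev).and self_mem_nhdsWithin).exists
    have hlu : sInf S < u := lt_of_le_of_lt h htu
    obtain ⟨s, hs, hsu⟩ := exists_lt_of_csInf_lt hne hlu
    have huS : u ∈ S := hup hs hsu.le
    apply hlt
    refine le_trans (show k ≤ _ from huS) (Finset.card_le_card ?_)
    intro i hi
    simp only [Finset.mem_filter, Finset.mem_univ, true_and] at hi ⊢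
    exact hu i hi
  · intro h
    exact csInf_le hbdd h

/-- The tail `x ↦ μ((x, ∞))` of a law on the real line. -/
def tail (μ : Measure ℝ) (x : ℝ) : ℝ := μ.real (Set.Ioi x)

/-- The residual (integrated-tail) law of a law `μ` of a nonnegative random variable `X` with
mean in `(0, ∞)`: it has density `P(X > y) / E[X]` on `(0, ∞)`, so that its tail at `x ≥ 0` is
`(1 / E[X]) * ∫_x^∞ P(X > y) dy`. -/
def residualLaw (μ : Measure ℝ) : Measure ℝ :=
  (volume.restrict (Set.Ioi 0)).withDensity
    fun y => μ (Set.Ioi y) / ENNReal.ofReal (∫ z, z ∂μ)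

/-- A law `μ` is subexponential if `P(X₁ + X₂ > x) / P(X₁ > x) → 2` as `x → ∞`, for `X₁, X₂`
independent with law `μ`. -/
def IsSubexponential (μ : Measure ℝ) : Prop :=
  Tendsto (fun x => tail (μ.conv μ) x / tail μ x) atTop (𝓝 2)

/-- `f(x) ≤ g(x)` asymptotically as `x → ∞`, for nonnegative `f` and `g`: up to a factor
`1 + o(1)`, that is `f(x) ≤ (1 + ε) g(x)` for every `ε > 0` and all large `x`. -/
def AsymptoticLE (f g : ℝ → ℝ) : Prop :=
  ∀ ε > 0, ∀ᶠ x in atTop, f x ≤ (1 + ε) * g x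

/-! ### Dynamics of the fork-join model: FCFS, cancel-on-completion

A job is described by the injective assignment `s` of its `nF` replicas to servers and by the
replica sizes `b`. The workload `v i` of server `i`, found by an arriving job, is the time after
which server `i` has become free of all replicas of earlier jobs. Under FCFS the replicas of
later jobs have no influence on it. -/

/-- Assignments of the `nF` replicas of a job to distinct servers form a finite, discrete
measurable space. -/
instance (nF N : ℕ) : MeasurableSpace (Fin nF ↪ Fin N) := ⊤

/-- Waiting time of replica `l`: the workload found at its server. -/
def replicaWait {N nF : ℕ} (v : Fin N → ℝ) (s : Fin nF ↪ Fin N) (l : Fin nF) : ℝ := v (s l)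

/-- `W_(nJ)`, the `nJ`-th order statistic of the waiting times of the replicas of a job. -/
def waitingTime {N nF : ℕ} (nJ : ℕ) (v : Fin N → ℝ) (s : Fin nF ↪ Fin N) : ℝ :=
  orderStat nJ (replicaWait v s)

/-- Response time: the time from arrival until `nJ` replicas have completed service. At that
moment all other replicas of the job are cancelled. -/
def responseTime {N nF : ℕ} (nJ : ℕ) (v : Fin N → ℝ) (s : Fin nF ↪ Fin N) (b : Fin nF → ℝ) : ℝ :=
  orderStat nJ fun l => replicaWait v s l + b l

open Classical in
/-- Workload of server `i` just after the job has been assigned. If replica `l` is sent to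
server `i`, then it starts after `v i`, unless the job has already been completed, and it leaves
the server at its own service completion after `v i + b l` or at its cancellation after
`responseTime`, whichever comes first. -/
def workloadAfterArrival {N nF : ℕ} (nJ : ℕ) (v : Fin N → ℝ) (s : Fin nF ↪ Fin N)
    (b : Fin nF → ℝ) (i : Fin N) : ℝ :=
  if h : ∃ l, s l = i then max (v i) (min (v i + b h.choose) (responseTime nJ v s b)) else v i

/-- Workloads found by the next job, which arrives after a further time `a`. -/
def nextWorkload {N nF : ℕ} (nJ : ℕ) (v : Fin N → ℝ) (s : Fin nF ↪ Fin N) (b : Fin nF → ℝ)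
    (a : ℝ) (i : Fin N) : ℝ :=
  max (workloadAfterArrival nJ v s b i - a) 0

/-- Workloads found by the `n`-th job, if job `0` finds the workloads `V₀`; `A n` is the time
between the arrivals of jobs `n` and `n + 1`, and `B n`, `S n` are the replica sizes and the
assignment of job `n`. -/
def workload {Ω : Type*} {N nF : ℕ} (nJ : ℕ) (V₀ : Ω → Fin N → ℝ) (A : ℕ → Ω → ℝ)
    (B : ℕ → Ω → Fin nF → ℝ) (S : ℕ → Ω → (Fin nF ↪ Fin N)) : ℕ → Ω → Fin N → ℝ
  | 0, ω => V₀ ω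
  | n + 1, ω => nextWorkload nJ (workload nJ V₀ A B S n ω) (S n ω) (B n ω) (A n ω)

/-! ### Stochastic assumptions -/

/-- The random input: i.i.d. nonnegative interarrival times with finite positive mean (renewal
arrivals), i.i.d. vectors of nonnegative replica sizes with an arbitrary joint law with equal
marginals, and i.i.d. assignments of the replicas to `nF` distinct servers chosen uniformly at
random, all independent. -/
structure IsInput {Ω : Type*} [MeasurableSpace Ω] (P : Measure Ω) {N nF : ℕ}
    (A : ℕ → Ω → ℝ) (B : ℕ → Ω → Fin nF → ℝ) (S : ℕ → Ω → (Fin nF ↪ Fin N)) : Prop where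
  measurable_A : ∀ n, Measurable (A n)
  measurable_B : ∀ n, Measurable (B n)
  measurable_S : ∀ n, Measurable (S n)
  nonneg_A : ∀ n, ∀ᵐ ω ∂P, 0 ≤ A n ω
  nonneg_B : ∀ n, ∀ᵐ ω ∂P, ∀ l, 0 ≤ B n ω l
  integrable_A : Integrable (A 0) P
  mean_A_pos : 0 < ∫ ω, A 0 ω ∂P
  law_A : ∀ n, P.map (A n) = P.map (A 0)
  law_B : ∀ n, P.map (B n) = P.map (B 0)
  marginals_B : ∀ l l', P.map (fun ω => B 0 ω l) = P.map (fun ω => B 0 ω l')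
  law_S : ∀ n s, P {ω | S n ω = s} = (Fintype.card (Fin nF ↪ Fin N) : ℝ≥0∞)⁻¹
  indep_B_S : ∀ n, IndepFun (B n) (S n) P
  indep_A_BS : ∀ n, IndepFun (A n) (fun ω => (B n ω, S n ω)) P
  indep_jobs : iIndepFun (fun n ω => (A n ω, B n ω, S n ω)) P

/-- The system is in steady state: the initial workloads are independent of the input, and the
workloads found by the `n`-th job have the same law for all `n`. -/
structure IsSteadyState {Ω : Type*} [MeasurableSpace Ω] (P : Measure Ω) {N nF : ℕ} (nJ : ℕ)
    (V₀ : Ω → Fin N → ℝ) (A : ℕ → Ω → ℝ) (B : ℕ → Ω → Fin nF → ℝ)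
    (S : ℕ → Ω → (Fin nF ↪ Fin N)) : Prop where
  measurable_init : Measurable V₀
  nonneg_init : ∀ᵐ ω ∂P, ∀ i, 0 ≤ V₀ ω i
  indep_init : IndepFun V₀ (fun ω n => (A n ω, B n ω, S n ω)) P
  stationary : ∀ n, P.map (workload nJ V₀ A B S n) = P.map V₀

/-- `K = (N choose nF) * nF! / (nF - nJ + 1)!`. -/
def thinning (N nF nJ : ℕ) : ℝ := (N.choose nF : ℝ) * (nF ! : ℝ) / ((nF - nJ + 1)! : ℝ)

end

end ForkJoin

/-! Both bounds compare a scalar function of the stationary workloads with a Lindley recursion of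
negative mean step. For the upper bound take the largest workload `M`, which dominates `W_(nJ)`. If
all replicas wait at most `M`, then `nJ` of them are done by `M + B_(nJ)` and the others are
cancelled, so `M` moves at most like the recursion with step `B_(nJ) - A` (`nextWorkload_le`). For
the lower bound fix the assignment `s` of the tagged job and take the minimum `m` of the workloads
at its servers other than the first `nJ - 1`; then `m ≤ W_(nJ)`. A job that sends its `nJ - 1`
smallest replicas to the omitted servers, in order, and the others in any order to the remaining
servers of `s`, raises `m` by at least `B_(nJ)` (`le_workloadAfterArrival_of_matching`). Given its
sizes, a job does so with probability `1 / K` (`integral_thinned`), so `m` moves at least like the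
recursion whose step is `B_(nJ)` thinned by `1 / K`, minus `A`.

The recursions are not solved. For a step `X`, put `D(w) = E[(w + X)⁺ - w⁺]` (`drift`). Testing
stationarity against the overshoot above a level `y` makes the integral of `D(m - y)` under the
stationary law nonnegative for dominated and nonpositive for dominating processes. Here `D(-y) =
E[(X - y)⁺]` is comparable to the residual tail, and `D(w)` tends to `E[X]` as `w → ∞`. The lower
bound follows almost at once (`integral_mul_le_tail`), because residual tails are insensitive to
shifts. For the upper bound (`asymptoticLE_of_lindley`), averaging over many levels makes the
contribution of levels near `y` negligible (`exists_averaged_drift_bound`), and the principle of one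
large summand (`IsSubexponential.eventually_setIntegral_le`) controls the rest. This gives first a
crude bound of the stationary tail by a multiple of the residual tail, and then the sharp constant.
-/

namespace ForkJoin

/-! ### Tails of subexponential laws -/

section Tail

variable {μ : Measure ℝ}

theorem tail_nonneg (x : ℝ) : 0 ≤ tail μ x := measureReal_nonneg

theorem tail_antitone [IsFiniteMeasure μ] : Antitone (tail μ) := fun _ _ h =>
  measureReal_mono (Set.Ioi_subset_Ioi h)

theorem measurable_tail [IsFiniteMeasure μ] : Measurable (tail μ) :=
  tail_antitone.measurable

theorem tail_le_one [IsProbabilityMeasure μ] (x : ℝ) : tail μ x ≤ 1 := measureReal_le_one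

theorem tendsto_tail [IsFiniteMeasure μ] : Tendsto (tail μ) atTop (𝓝 0) := by
  have h : Tendsto (fun x => μ (Set.Ioi x)) atTop (𝓝 (μ (⋂ x : ℝ, Set.Ioi x))) :=
    tendsto_measure_iInter_atTop (fun _ => measurableSet_Ioi.nullMeasurableSet)
      (fun _ _ h => Set.Ioi_subset_Ioi h) ⟨0, measure_ne_top _ _⟩
  have h0 : (⋂ x : ℝ, Set.Ioi x) = ∅ := by
    ext y
    simp only [Set.mem_iInter, Set.mem_Ioi, Set.mem_empty_iff_false, iff_false, not_forall, not_lt]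
    exact ⟨y, le_rfl⟩
  rw [h0, measure_empty] at h
  exact (ENNReal.tendsto_toReal ENNReal.zero_ne_top).comp h

theorem integrable_tail_comp [IsFiniteMeasure μ] {α : Type*} [MeasurableSpace α] {ν : Measure α}
    [IsFiniteMeasure ν] {f : α → ℝ} (hf : Measurable f) : Integrable (fun y => tail μ (f y)) ν := by
  refine Integrable.of_bound (measurable_tail.comp hf).aestronglyMeasurable (μ.real Set.univ) ?_
  refine Eventually.of_forall fun y => ?_
  rw [Real.norm_of_nonneg (tail_nonneg _)]
  exact measureReal_mono (Set.subset_univ _)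

theorem tail_conv (μ ν : Measure ℝ) [IsFiniteMeasure μ] [IsFiniteMeasure ν] (x : ℝ) :
    tail (μ.conv ν) x = ∫ y, tail ν (x - y) ∂μ := by
  have hm : MeasurableSet {p : ℝ × ℝ | x < p.1 + p.2} :=
    measurableSet_lt measurable_const (measurable_fst.add measurable_snd)
  have h1 : tail (μ.conv ν) x = (μ.prod ν).real {p : ℝ × ℝ | x < p.1 + p.2} := by
    simp only [tail, Measure.real, Measure.conv]
    rw [Measure.map_apply (by fun_prop) measurableSet_Ioi]
    rfl
  rw [h1, measureReal_def, Measure.prod_apply hm,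
    integral_eq_lintegral_of_nonneg_ae (Eventually.of_forall fun y => tail_nonneg _)
      (measurable_tail.comp (by fun_prop)).aestronglyMeasurable]
  congr 1
  refine lintegral_congr fun y => ?_
  rw [tail, ofReal_measureReal]
  congr 1
  ext z
  simp [sub_lt_iff_lt_add']

theorem IsSubexponential.tail_pos [IsFiniteMeasure μ] (h : IsSubexponential μ) (x : ℝ) :
    0 < tail μ x := by
  by_contra hx
  have h0 : ∀ y, x ≤ y → tail μ y = 0 := fun y hy =>
    le_antisymm ((tail_antitone hy).trans (not_lt.mp hx)) (tail_nonneg y)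
  have h1 : Tendsto (fun y => tail (μ.conv μ) y / tail μ y) atTop (𝓝 0) := by
    refine tendsto_const_nhds.congr' ?_
    filter_upwards [eventually_ge_atTop x] with y hy
    rw [h0 y hy, div_zero]
  exact two_ne_zero (tendsto_nhds_unique h h1)

variable [IsProbabilityMeasure μ]

theorem measureReal_Iic (t : ℝ) : μ.real (Set.Iic t) = 1 - tail μ t := by
  rw [← Set.compl_Ioi, probReal_compl_eq_one_sub measurableSet_Ioi, tail]

theorem measureReal_Ioc {t x : ℝ} (h : t ≤ x) : μ.real (Set.Ioc t x) = tail μ t - tail μ x := by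
  rw [tail, tail, ← measureReal_sdiff (Set.Ioi_subset_Ioi h) measurableSet_Ioi, Set.Ioi_sdiff_Ioi]

theorem tail_of_neg (hμ : ∀ᵐ y ∂μ, 0 ≤ y) {x : ℝ} (hx : x < 0) : tail μ x = 1 := by
  have : μ (Set.Ioi x) = 1 := by
    refine (prob_compl_eq_zero_iff measurableSet_Ioi).mp (measure_mono_null (fun y hy => ?_) hμ)
    exact not_le.mpr (lt_of_le_of_lt (Set.notMem_Ioi.mp hy) hx)
  simp [tail, Measure.real, this]

/-- One large summand dominates: a sum above `x` with neither summand responsible for it alone has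
probability of smaller order. -/
theorem IsSubexponential.eventually_setIntegral_le (hμ : ∀ᵐ y ∂μ, 0 ≤ y)
    (h : IsSubexponential μ) (t : ℝ) {η : ℝ} (hη : 0 < η) :
    ∀ᶠ x in atTop, ∫ y in Set.Ioc t x, tail μ (x - y) ∂μ ≤ (tail μ t + η) * tail μ x := by
  filter_upwards [h.eventually_lt_const (show (2 : ℝ) < 2 + η by linarith),
    eventually_ge_atTop t] with x hx hxt
  rw [div_lt_iff₀ (h.tail_pos x), tail_conv] at hx
  have hi : Integrable (fun y => tail μ (x - y)) μ :=
    integrable_tail_comp (measurable_const.sub measurable_id)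
  -- The first and last of the three ranges of `y` contribute at least `(1 - tail μ t) * tail μ x`
  -- and `tail μ x`; the total is below `(2 + η) * tail μ x`, which leaves the claimed bound for the
  -- middle range.
  have e1 : ∫ y, tail μ (x - y) ∂μ = ∫ y in Set.Iic t, tail μ (x - y) ∂μ
      + (∫ y in Set.Ioc t x, tail μ (x - y) ∂μ + ∫ y in Set.Ioi x, tail μ (x - y) ∂μ) := by
    rw [← setIntegral_union (Set.Ioc_disjoint_Ioi le_rfl) measurableSet_Ioi hi.integrableOn
      hi.integrableOn, Set.Ioc_union_Ioi_eq_Ioi hxt, ← Set.compl_Iic,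
      integral_add_compl measurableSet_Iic hi]
  have e2 : tail μ x ≤ ∫ y in Set.Ioi x, tail μ (x - y) ∂μ := by
    rw [setIntegral_congr_fun (g := fun _ => (1 : ℝ)) measurableSet_Ioi]
    · simp [tail]
    · intro y hy
      exact tail_of_neg hμ (sub_neg.mpr hy)
  have e3 : (1 - tail μ t) * tail μ x ≤ ∫ y in Set.Iic t, tail μ (x - y) ∂μ := by
    calc _ = ∫ y in Set.Iic t, tail μ x ∂μ := by simp [measureReal_Iic]
      _ ≤ _ := by
        refine integral_mono_ae (integrable_const _) hi.integrableOn ?_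
        filter_upwards [ae_restrict_of_ae hμ] with y hy
        exact tail_antitone (by linarith)
  nlinarith

/-- Subexponential laws are long-tailed. -/
theorem IsSubexponential.eventually_tail_le (hμ : ∀ᵐ y ∂μ, 0 ≤ y)
    (h : IsSubexponential μ) (t : ℝ) {ε : ℝ} (hε : 0 < ε) :
    ∀ᶠ x in atTop, tail μ x ≤ (1 + ε) * tail μ (x + t) := by
  have hpt := h.tail_pos t
  -- This `η` solves `tail μ t + η = (1 + ε) * (tail μ t - η)`.
  set η := ε * tail μ t / (2 + ε) with hηd
  have hη : 0 < η := by positivity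
  have hηe : η * (2 + ε) = ε * tail μ t := by rw [hηd]; field_simp
  have h1 := h.eventually_setIntegral_le hμ t hη
  have h2 : ∀ᶠ x in atTop, tail μ x < η := tendsto_tail.eventually_lt_const hη
  filter_upwards [(tendsto_atTop_add_const_right atTop t tendsto_id).eventually h1,
    (tendsto_atTop_add_const_right atTop t tendsto_id).eventually h2,
    eventually_ge_atTop 0] with x h1 h2 hx0
  simp only [id] at h1 h2
  have hlow : (tail μ t - tail μ (x + t)) * tail μ x
      ≤ ∫ y in Set.Ioc t (x + t), tail μ (x + t - y) ∂μ := by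
    calc _ = ∫ y in Set.Ioc t (x + t), tail μ x ∂μ := by
          simp [measureReal_Ioc (show t ≤ x + t by linarith)]
      _ ≤ _ := by
        refine setIntegral_mono_on (integrable_const _).integrableOn
          (integrable_tail_comp (measurable_const.sub measurable_id)).integrableOn
          measurableSet_Ioc fun y hy => tail_antitone (by linarith [hy.1])
  have hp := h.tail_pos (x + t)
  have hpx := h.tail_pos x
  have hd : 0 < tail μ t - η := by
    rw [sub_pos, hηd, div_lt_iff₀ (by positivity)]
    linarith
  have h3 : (tail μ t - η) * tail μ x ≤ (tail μ t + η) * tail μ (x + t) := by nlinarith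
  have h4 : tail μ t + η = (1 + ε) * (tail μ t - η) := by linarith
  rw [h4] at h3
  exact le_of_mul_le_mul_left (by linarith) hd

end Tail

/-! ### The residual law -/

section Residual

variable {μ : Measure ℝ}

theorem residualLaw_Ioi [IsFiniteMeasure μ] {x : ℝ} (hx : 0 ≤ x) :
    residualLaw μ (Set.Ioi x)
      = (∫⁻ z, ENNReal.ofReal (max (z - x) 0) ∂μ) / ENNReal.ofReal (∫ z, z ∂μ) := by
  have hanti : Antitone fun y : ℝ => μ (Set.Ioi y) := fun _ _ h =>
    measure_mono (Set.Ioi_subset_Ioi h)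
  rw [residualLaw, withDensity_apply _ measurableSet_Ioi, Measure.restrict_restrict
    measurableSet_Ioi, Set.inter_eq_left.mpr (Set.Ioi_subset_Ioi hx)]
  simp_rw [div_eq_mul_inv]
  rw [lintegral_mul_const _ hanti.measurable]
  congr 1
  rw [lintegral_eq_lintegral_meas_lt μ (f := fun z => max (z - x) 0)
    (Eventually.of_forall fun z => le_max_right _ _) (by fun_prop)]
  rw [← lintegral_indicator measurableSet_Ioi, ← lintegral_indicator measurableSet_Ioi,
    ← lintegral_add_right_eq_self _ x]
  refine lintegral_congr fun y => ?_
  simp only [Set.indicator, Set.mem_Ioi, lt_add_iff_pos_left]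
  split_ifs with hy
  · congr 1
    ext z
    simp only [Set.mem_Ioi, Set.mem_ofPred_eq, lt_max_iff, not_lt.mpr hy.le, or_false]
    constructor <;> intro h <;> linarith
  · rfl

theorem tail_residualLaw [IsFiniteMeasure μ] (hint : Integrable (fun z => z) μ)
    (hpos : 0 < ∫ z, z ∂μ) {x : ℝ} (hx : 0 ≤ x) :
    tail (residualLaw μ) x = (∫ z, max (z - x) 0 ∂μ) / ∫ z, z ∂μ := by
  have hi : Integrable (fun z => max (z - x) 0) μ := (hint.sub (integrable_const x)).pos_part
  rw [tail, Measure.real, residualLaw_Ioi hx, ENNReal.toReal_div, ENNReal.toReal_ofReal hpos.le,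
    ← ofReal_integral_eq_lintegral_ofReal hi (Eventually.of_forall fun z => le_max_right _ _),
    ENNReal.toReal_ofReal (integral_nonneg (f := fun z => max (z - x) 0) fun z => le_max_right _ _)]

theorem residualLaw_nonneg : ∀ᵐ y ∂residualLaw μ, 0 ≤ y := by
  refine (withDensity_absolutelyContinuous _ _).ae_le ?_
  filter_upwards [ae_restrict_mem measurableSet_Ioi] with y hy using le_of_lt hy

theorem isProbabilityMeasure_residualLaw [IsFiniteMeasure μ] (hint : Integrable (fun z => z) μ)
    (hnn : ∀ᵐ z ∂μ, 0 ≤ z) (hpos : 0 < ∫ z, z ∂μ) : IsProbabilityMeasure (residualLaw μ) := by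
  constructor
  have h0 : residualLaw μ Set.univ = residualLaw μ (Set.Ioi 0) := by
    rw [residualLaw, withDensity_apply _ measurableSet_Ioi, withDensity_apply _ MeasurableSet.univ,
      Measure.restrict_univ, Measure.restrict_restrict measurableSet_Ioi, Set.inter_self]
  rw [h0, residualLaw_Ioi le_rfl]
  have : ∫⁻ z, ENNReal.ofReal (max (z - 0) 0) ∂μ = ENNReal.ofReal (∫ z, z ∂μ) := by
    rw [ofReal_integral_eq_lintegral_ofReal hint hnn]
    refine lintegral_congr fun z => ?_
    rcases le_total z 0 with hz | hz <;> simp [hz, ENNReal.ofReal_of_nonpos]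
  rw [this, ENNReal.div_self (by simpa using hpos) ENNReal.ofReal_ne_top]

/-- With mean zero the density is `0 / 0 = 0`, so the residual law would be the zero measure, whose
tail vanishes; a subexponential tail is everywhere positive. -/
theorem IsSubexponential.integral_pos (h : IsSubexponential (residualLaw μ))
    [IsFiniteMeasure μ] (hint : Integrable (fun z => z) μ) (hnn : ∀ᵐ z ∂μ, 0 ≤ z) :
    0 < ∫ z, z ∂μ := by
  refine lt_of_le_of_ne (integral_nonneg_of_ae hnn) fun h0 => ?_
  have h1 : ∀ᵐ z ∂μ, z = 0 := (integral_eq_zero_iff_of_nonneg_ae hnn hint).mp h0.symm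
  have h2 : residualLaw μ = 0 := by
    refine Measure.measure_univ_eq_zero.mp ?_
    rw [residualLaw, withDensity_apply _ MeasurableSet.univ, Measure.restrict_univ,
      setLIntegral_congr_fun (g := fun _ => 0) measurableSet_Ioi]
    · simp
    · intro y hy
      have : μ (Set.Ioi y) = 0 := by
        refine measure_mono_null (fun z hz => ?_) h1
        exact (lt_trans hy hz).ne'
      simp [this]
  rw [h2] at h
  exact absurd (h.tail_pos 0) (by simp [tail])

end Residual

/-! ### The Lindley recursion and the drift of its overshoot -/

section Drift

/-- Mean increase of the positive part of a random walk with step law `μ`, started at `w`. -/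
noncomputable def drift (μ : Measure ℝ) (w : ℝ) : ℝ := ∫ ξ, (max (w + ξ) 0 - max w 0) ∂μ

theorem abs_max_add_sub_le (w ξ : ℝ) : |max (w + ξ) 0 - max w 0| ≤ |ξ| := by
  have := abs_max_sub_max_le_abs (w + ξ) w 0
  simpa using this

variable {μ : Measure ℝ}

theorem integrable_drift (hμ : Integrable (fun ξ => ξ) μ) (w : ℝ) :
    Integrable (fun ξ => max (w + ξ) 0 - max w 0) μ :=
  hμ.mono (by fun_prop) (Eventually.of_forall fun ξ => abs_max_add_sub_le w ξ)

theorem drift_neg {y : ℝ} (hy : 0 ≤ y) : drift μ (-y) = ∫ ξ, max (ξ - y) 0 ∂μ := by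
  refine integral_congr_ae (Eventually.of_forall fun ξ => ?_)
  simp [hy, neg_add_eq_sub]

theorem integral_le_drift (hμ : Integrable (fun ξ => ξ) μ) {w : ℝ} (hw : 0 ≤ w) :
    ∫ ξ, ξ ∂μ ≤ drift μ w := by
  refine integral_mono hμ (integrable_drift hμ w) fun ξ => ?_
  simp only [max_eq_left hw]
  linarith [le_max_left (w + ξ) 0]

theorem drift_le (hμ : Integrable (fun ξ => ξ) μ) (w : ℝ) :
    drift μ w ≤ ∫ ξ, max ξ 0 ∂μ := by
  refine integral_mono (integrable_drift hμ w) hμ.pos_part fun ξ => ?_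
  show max (w + ξ) 0 - max w 0 ≤ max ξ 0
  rcases max_cases (w + ξ) 0 with h | h <;> rcases max_cases w 0 with h' | h' <;>
    rcases max_cases ξ 0 with h'' | h'' <;> linarith

theorem tendsto_drift (hμ : Integrable (fun ξ => ξ) μ) :
    Tendsto (drift μ) atTop (𝓝 (∫ ξ, ξ ∂μ)) := by
  refine tendsto_integral_filter_of_dominated_convergence (fun ξ => |ξ|)
    (Eventually.of_forall fun w => by fun_prop)
    (Eventually.of_forall fun w => Eventually.of_forall fun ξ => abs_max_add_sub_le w ξ)
    hμ.abs (Eventually.of_forall fun ξ => ?_)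
  refine tendsto_const_nhds.congr' ?_
  filter_upwards [eventually_ge_atTop 0, eventually_ge_atTop (-ξ)] with w h1 h2
  rw [max_eq_left h1, max_eq_left (by linarith)]
  ring

theorem measurable_drift [SFinite μ] : Measurable (drift μ) := by
  have : StronglyMeasurable (fun p : ℝ × ℝ => max (p.1 + p.2) 0 - max p.1 0) :=
    Measurable.stronglyMeasurable (by fun_prop)
  exact this.integral_prod_right.measurable

theorem abs_drift_le (hμ : Integrable (fun ξ => ξ) μ) (w : ℝ) :
    |drift μ w| ≤ ∫ ξ, |ξ| ∂μ := by
  refine (abs_integral_le_integral_abs).trans ?_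
  exact integral_mono (integrable_drift hμ w).abs hμ.abs fun ξ => abs_max_add_sub_le w ξ

theorem integrable_drift_comp [SFinite μ] (hμ : Integrable (fun ξ => ξ) μ) {α : Type*}
    [MeasurableSpace α] {ν : Measure α} [IsFiniteMeasure ν] {f : α → ℝ} (hf : Measurable f) :
    Integrable (fun m => drift μ (f m)) ν :=
  Integrable.of_bound (measurable_drift.comp hf).aestronglyMeasurable _
    (Eventually.of_forall fun m => abs_drift_le hμ (f m))

end Drift

/-! ### Drift balance for stationary processes -/

section Stationary

variable {Ω : Type*} [MeasurableSpace Ω] {P : Measure Ω} [IsProbabilityMeasure P]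
  {M X M' : Ω → ℝ}

theorem integral_drift_eq (hM : Measurable M) (hX : Measurable X) (hind : IndepFun M X P)
    (hXi : Integrable X P) (y : ℝ) :
    ∫ m, drift (P.map X) (m - y) ∂(P.map M)
      = ∫ ω, (max (M ω - y + X ω) 0 - max (M ω - y) 0) ∂P := by
  have hprod := (indepFun_iff_map_prod_eq_prod_map_map hM.aemeasurable hX.aemeasurable).mp hind
  have hi : Integrable (fun p : ℝ × ℝ => max (p.1 - y + p.2) 0 - max (p.1 - y) 0)
      ((P.map M).prod (P.map X)) := by
    rw [← hprod, integrable_map_measure (by fun_prop) (by fun_prop)]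
    refine hXi.mono (by fun_prop) (Eventually.of_forall fun ω => ?_)
    exact abs_max_add_sub_le _ _
  have := Measure.isProbabilityMeasure_map hX.aemeasurable (μ := P)
  have := Measure.isProbabilityMeasure_map hM.aemeasurable (μ := P)
  simp only [drift]
  rw [← integral_prod _ hi, ← hprod, integral_map (by fun_prop) (by fun_prop)]

theorem abs_truncate_sub_le (a b c : ℝ) :
    |min (max a 0) c - min (max b 0) c| ≤ |a - b| :=
  (abs_min_sub_min_le_max _ _ _ _).trans (by
    simpa using (abs_max_sub_max_le_max a 0 b 0))

theorem integrable_truncate {f : Ω → ℝ} (hf : Measurable f) {c : ℝ} (hc : 0 ≤ c) :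
    Integrable (fun ω => min (max (f ω) 0) c) P := by
  refine Integrable.of_bound (by fun_prop) c (Eventually.of_forall fun ω => ?_)
  rw [Real.norm_of_nonneg (le_min (le_max_right _ _) hc)]
  exact min_le_right _ _

/-- The stationary variable `M` need not have a mean, so its overshoot is truncated at `n` before
expectations are subtracted. The truncated increments stay dominated by `|X|`. -/
theorem tendsto_integral_truncate_sub (hM : Measurable M) (hX : Measurable X)
    (hXi : Integrable X P) (y : ℝ) :
    Tendsto (fun n : ℕ => ∫ ω, min (max (M ω - y + X ω) 0) n ∂P
        - ∫ ω, min (max (M ω - y) 0) n ∂P) atTop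
      (𝓝 (∫ ω, (max (M ω - y + X ω) 0 - max (M ω - y) 0) ∂P)) := by
  have e : ∀ n : ℕ, ∫ ω, min (max (M ω - y + X ω) 0) n ∂P - ∫ ω, min (max (M ω - y) 0) n ∂P
      = ∫ ω, (min (max (M ω - y + X ω) 0) n - min (max (M ω - y) 0) n) ∂P := fun n =>
    (integral_sub (integrable_truncate (by fun_prop) n.cast_nonneg)
      (integrable_truncate (by fun_prop) n.cast_nonneg)).symm
  simp_rw [e]
  refine tendsto_integral_of_dominated_convergence (fun ω => |X ω|) (fun n => by fun_prop)
    hXi.abs (fun n => Eventually.of_forall fun ω => ?_) (Eventually.of_forall fun ω => ?_)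
  · exact (abs_truncate_sub_le _ _ _).trans (by simp)
  · refine tendsto_const_nhds.congr' ?_
    filter_upwards [tendsto_natCast_atTop_atTop.eventually_ge_atTop (max (M ω - y + X ω) 0),
      tendsto_natCast_atTop_atTop.eventually_ge_atTop (max (M ω - y) 0)] with n h1 h2
    rw [min_eq_left h1, min_eq_left h2]

/-- If `M` is stationary and moves at most like the Lindley recursion, its drift is nonnegative. -/
theorem integral_drift_nonneg (hM : Measurable M) (hX : Measurable X) (hM' : Measurable M')
    (hind : IndepFun M X P) (hXi : Integrable X P) (hlaw : P.map M' = P.map M)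
    (hstep : ∀ᵐ ω ∂P, M' ω ≤ max (M ω + X ω) 0) {y : ℝ} (hy : 0 ≤ y) :
    0 ≤ ∫ m, drift (P.map X) (m - y) ∂(P.map M) := by
  rw [integral_drift_eq hM hX hind hXi]
  refine ge_of_tendsto' (tendsto_integral_truncate_sub hM hX hXi y) fun n => sub_nonneg.mpr ?_
  have e : ∫ ω, min (max (M ω - y) 0) n ∂P = ∫ ω, min (max (M' ω - y) 0) n ∂P := by
    rw [← integral_map (f := fun m => min (max (m - y) 0) (n : ℝ)) hM.aemeasurable (by fun_prop),
      ← hlaw, integral_map hM'.aemeasurable (by fun_prop)]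
  rw [e]
  refine integral_mono_ae (integrable_truncate (by fun_prop) n.cast_nonneg)
    (integrable_truncate (by fun_prop) n.cast_nonneg) ?_
  filter_upwards [hstep] with ω hω
  refine min_le_min_right _ (max_le ?_ (le_max_right _ _))
  -- Since `y ≥ 0`, the reflection of the recursion at `0` does not affect the overshoot above `y`.
  rcases le_max_iff.mp hω with h | h
  · exact le_max_of_le_left (by linarith)
  · exact le_max_of_le_right (by linarith)

/-- If `M` is stationary and moves at least like the Lindley recursion, its drift is nonpositive. -/
theorem integral_drift_nonpos (hM : Measurable M) (hX : Measurable X) (hM' : Measurable M')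
    (hind : IndepFun M X P) (hXi : Integrable X P) (hlaw : P.map M' = P.map M)
    (hstep : ∀ᵐ ω ∂P, M ω + X ω ≤ M' ω) (y : ℝ) :
    ∫ m, drift (P.map X) (m - y) ∂(P.map M) ≤ 0 := by
  rw [integral_drift_eq hM hX hind hXi]
  refine le_of_tendsto' (tendsto_integral_truncate_sub hM hX hXi y) fun n => sub_nonpos.mpr ?_
  have e : ∫ ω, min (max (M ω - y) 0) n ∂P = ∫ ω, min (max (M' ω - y) 0) n ∂P := by
    rw [← integral_map (f := fun m => min (max (m - y) 0) (n : ℝ)) hM.aemeasurable (by fun_prop),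
      ← hlaw, integral_map hM'.aemeasurable (by fun_prop)]
  rw [e]
  refine integral_mono_ae (integrable_truncate (by fun_prop) n.cast_nonneg)
    (integrable_truncate (by fun_prop) n.cast_nonneg) ?_
  filter_upwards [hstep] with ω hω
  exact min_le_min_right _ (max_le_max_right _ (by linarith))

end Stationary

/-! ### Asymptotic lower bound -/

section Lower

variable {Ω : Type*} [MeasurableSpace Ω] {P : Measure Ω} [IsProbabilityMeasure P]
  {M X M' : Ω → ℝ}

/-- A stationary nonnegative process that moves at least like the Lindley recursion with mean step
`-a` exceeds `x` with probability at least `E[(X - x)⁺] P(M ≤ x) / a`. -/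
theorem integral_mul_le_tail (hM : Measurable M) (hX : Measurable X) (hM' : Measurable M')
    (hM0 : ∀ᵐ ω ∂P, 0 ≤ M ω)
    (hind : IndepFun M X P) (hXi : Integrable X P) (hlaw : P.map M' = P.map M)
    (hstep : ∀ᵐ ω ∂P, M ω + X ω ≤ M' ω) (x : ℝ) :
    (∫ ω, max (X ω - x) 0 ∂P) * (1 - tail (P.map M) x)
      ≤ (-∫ ω, X ω ∂P) * tail (P.map M) x := by
  have := Measure.isProbabilityMeasure_map hX.aemeasurable (μ := P)
  have := Measure.isProbabilityMeasure_map hM.aemeasurable (μ := P)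
  have h0 := integral_drift_nonpos hM hX hM' hind hXi hlaw hstep x
  have hXi' : Integrable (fun ξ => ξ) (P.map X) := by
    rwa [integrable_map_measure (by fun_prop) hX.aemeasurable]
  have hint : Integrable (fun m => drift (P.map X) (m - x)) (P.map M) :=
    integrable_drift_comp hXi' (by fun_prop)
  rw [← integral_add_compl measurableSet_Iic hint, Set.compl_Iic] at h0
  -- Below level `x` the drift is `E[(X - (x - m))⁺] ≥ E[(X - x)⁺]`, since `m ≥ 0`; above `x` it is
  -- at least `E[X]`.
  have e1 : (∫ ω, max (X ω - x) 0 ∂P) * (1 - tail (P.map M) x)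
      ≤ ∫ m in Set.Iic x, drift (P.map X) (m - x) ∂(P.map M) := by
    rw [← measureReal_Iic, mul_comm, ← smul_eq_mul, ← setIntegral_const]
    refine integral_mono_ae (integrable_const _) hint.integrableOn ?_
    have hM0' : ∀ᵐ m ∂(P.map M), 0 ≤ m := by
      rw [ae_map_iff hM.aemeasurable measurableSet_Ici]; exact hM0
    filter_upwards [ae_restrict_of_ae hM0', ae_restrict_mem measurableSet_Iic] with m h1 h2
    rw [show m - x = -(x - m) by ring, drift_neg (sub_nonneg.mpr h2),
      integral_map hX.aemeasurable (by fun_prop)]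
    refine integral_mono (hXi.sub (integrable_const _)).pos_part
      (hXi.sub (integrable_const _)).pos_part fun ω => ?_
    exact max_le_max_right _ (show X ω - x ≤ X ω - (x - m) by linarith)
  have e2 : (∫ ω, X ω ∂P) * tail (P.map M) x
      ≤ ∫ m in Set.Ioi x, drift (P.map X) (m - x) ∂(P.map M) := by
    rw [tail, mul_comm, ← smul_eq_mul, ← setIntegral_const]
    refine setIntegral_mono_on (integrable_const _).integrableOn hint.integrableOn
      measurableSet_Ioi fun m hm => ?_
    have := integral_le_drift hXi' (sub_nonneg.mpr (le_of_lt hm : x ≤ m))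
    rwa [integral_map hX.aemeasurable (by fun_prop)] at this
  linarith

end Lower

/-! ### Asymptotic upper bound -/

section Upper

/-- Both sides are `P(M + Y > x, Y > t)` for independent `M` and `Y` with laws `ν` and `μ`, computed
by conditioning on one or the other. -/
theorem integral_tail_max_eq (ν μ : Measure ℝ) [IsFiniteMeasure ν] [IsFiniteMeasure μ] (x t : ℝ) :
    ∫ m, tail μ (max (x - m) t) ∂ν = ∫ y in Set.Ioi t, tail ν (x - y) ∂μ := by
  rw [← tail_conv, Measure.conv_comm, tail_conv]
  refine integral_congr_ae (Eventually.of_forall fun m => ?_)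
  simp only [tail]
  rw [measureReal_restrict_apply measurableSet_Ioi, Set.Ioi_inter_Ioi]

theorem integral_tail_max_le {ν μ : Measure ℝ} [IsProbabilityMeasure ν] [IsProbabilityMeasure μ]
    {x t C : ℝ} (ht : 0 ≤ t) (htx : t ≤ x)
    (hC : ∀ y, 0 ≤ y → y ≤ x → tail ν y ≤ C * tail μ y) :
    ∫ m, tail μ (max (x - m) t) ∂ν
      ≤ tail μ x + C * ∫ y in Set.Ioc t x, tail μ (x - y) ∂μ := by
  have hi : Integrable (fun y => tail ν (x - y)) μ := integrable_tail_comp (by fun_prop)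
  rw [integral_tail_max_eq, ← Set.Ioc_union_Ioi_eq_Ioi htx,
    setIntegral_union (Set.Ioc_disjoint_Ioi le_rfl) measurableSet_Ioi hi.integrableOn
      hi.integrableOn, add_comm]
  refine add_le_add ?_ ?_
  · calc _ ≤ ∫ y in Set.Ioi x, (1 : ℝ) ∂μ :=
        integral_mono hi.integrableOn (integrable_const _) fun y => tail_le_one _
      _ = tail μ x := by simp [tail]
  · rw [← integral_const_mul]
    refine setIntegral_mono_on hi.integrableOn
      ((integrable_tail_comp (by fun_prop)).const_mul C).integrableOn measurableSet_Ioc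
      fun y hy => hC _ (by linarith [hy.2]) (by linarith [hy.1])

variable {Ω : Type*} [MeasurableSpace Ω] {P : Measure Ω} [IsProbabilityMeasure P]
  {M X M' : Ω → ℝ} {μ : Measure ℝ} [IsProbabilityMeasure μ] {c a : ℝ}

/-- The drift at `m - y` is small by `hXtail` for `m` well below `y` and close to `-a` for `m` well
above `y`. In a window around `y` it is only known to be at most `c₀ = E[X⁺]`. Using `n` levels with
disjoint windows, the windows together have mass at most `tail ν x`, so averaging reduces their
contribution to `c₀ / n ≤ δ` times that tail. -/
theorem exists_averaged_drift_bound (hM : Measurable M) (hX : Measurable X) (hM' : Measurable M')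
    (hind : IndepFun M X P) (hXi : Integrable X P) (hlaw : P.map M' = P.map M)
    (hstep : ∀ᵐ ω ∂P, M' ω ≤ max (M ω + X ω) 0) (ha : ∫ ω, X ω ∂P = -a) (hc : 0 ≤ c)
    (hXtail : ∀ y, 0 ≤ y → ∫ ω, max (X ω - y) 0 ∂P ≤ c * tail μ y)
    (t : ℝ) {δ : ℝ} (hδ : 0 < δ) (hδa : δ ≤ a) :
    ∃ R > 0, ∀ x ≥ 0, (a - δ) * tail (P.map M) (x + R)
      ≤ c * ∫ m, tail μ (max (x - m) t) ∂(P.map M) + δ * tail (P.map M) x := by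
  have := Measure.isProbabilityMeasure_map hX.aemeasurable (μ := P)
  have := Measure.isProbabilityMeasure_map hM.aemeasurable (μ := P)
  set ν := P.map M with hν
  set D := drift (P.map X) with hD
  have hXi' : Integrable (fun ξ => ξ) (P.map X) := by
    rwa [integrable_map_measure (by fun_prop) hX.aemeasurable]
  have hlim : Tendsto D atTop (𝓝 (-a)) := by
    have h := tendsto_drift hXi'
    rwa [integral_map hX.aemeasurable (by fun_prop), ha] at h
  obtain ⟨L₀, hL₀⟩ := eventually_atTop.mp
    (hlim.eventually_lt_const (show -a < -(a - δ) by linarith))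
  -- The half-width `L` of a window is at least `L₀`, for the drift beyond the window, at least `t`,
  -- for the truncation in `max (x - m) t`, and positive.
  set L := max (max L₀ t) 1 with hL
  have hL1 : 1 ≤ L := le_max_right _ _
  have hLt : t ≤ L := (le_max_right _ _).trans (le_max_left _ _)
  have hLL₀ : L₀ ≤ L := (le_max_left _ _).trans (le_max_left _ _)
  set c₀ := ∫ ξ, max ξ 0 ∂(P.map X) with hc₀
  have hc₀0 : 0 ≤ c₀ := integral_nonneg fun ξ => le_max_right _ _
  obtain ⟨n, hn⟩ := exists_nat_ge (max (c₀ / δ) 1)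
  have hn1 : (1 : ℝ) ≤ n := (le_max_right _ _).trans hn
  have hnδ : c₀ ≤ n * δ := (div_le_iff₀ hδ).mp ((le_max_left _ _).trans hn)
  refine ⟨2 * L * n, by positivity, fun x hx => ?_⟩
  set Q := ∫ m, tail μ (max (x - m) t) ∂ν with hQ
  have hone : ∀ j ∈ Finset.range n, 0 ≤ c * Q
      + c₀ * (tail ν (x + 2 * L * j) - tail ν (x + 2 * L * (j + 1 : ℕ)))
      - (a - δ) * tail ν (x + 2 * L * n) := by
    intro j hj
    have hjn : (j : ℝ) + 1 ≤ n := by exact_mod_cast Finset.mem_range.mp hj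
    have hj0 : (0 : ℝ) ≤ j := j.cast_nonneg
    have hLj : 0 ≤ L * j := by positivity
    have hLjn : L * (j + 1) ≤ L * n := mul_le_mul_of_nonneg_left hjn (by linarith)
    set y := x + L + 2 * L * j with hy
    have h0 : 0 ≤ ∫ m, D (m - y) ∂ν :=
      integral_drift_nonneg hM hX hM' hind hXi hlaw hstep (by rw [hy]; linarith)
    set I := Set.Ioc (x + 2 * L * j) (x + 2 * L * (j + 1 : ℕ)) with hI
    have hpt : ∀ m, D (m - y) ≤ c * tail μ (max (x - m) t) + I.indicator (fun _ => c₀) m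
        - (Set.Ioi (x + 2 * L * n)).indicator (fun _ => a - δ) m := by
      intro m
      have hq : 0 ≤ c * tail μ (max (x - m) t) := mul_nonneg hc (tail_nonneg _)
      have hI' : 0 ≤ I.indicator (fun _ => c₀) m := Set.indicator_nonneg (fun _ _ => hc₀0) m
      rcases le_or_gt m (x + 2 * L * j) with h1 | h1
      · have hm : m ∉ Set.Ioi (x + 2 * L * n) := by
          simp only [Set.mem_Ioi, not_lt]; linarith
        rw [Set.indicator_of_notMem hm]
        have hw : 0 ≤ y - m := by rw [hy]; linarith
        have h2 : D (m - y) ≤ c * tail μ (y - m) := by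
          rw [show m - y = -(y - m) by ring, hD, drift_neg hw,
            integral_map hX.aemeasurable (by fun_prop)]
          exact hXtail _ hw
        have h3 : tail μ (y - m) ≤ tail μ (max (x - m) t) :=
          tail_antitone (max_le (by rw [hy]; linarith) (by rw [hy]; linarith))
        linarith [mul_le_mul_of_nonneg_left h3 hc]
      · rcases le_or_gt m (x + 2 * L * (j + 1 : ℕ)) with h2 | h2
        · have hm : m ∉ Set.Ioi (x + 2 * L * n) := by
            simp only [Set.mem_Ioi, not_lt]; push_cast at h2; linarith
          rw [Set.indicator_of_notMem hm, Set.indicator_of_mem (show m ∈ I from ⟨h1, h2⟩)]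
          have : D (m - y) ≤ c₀ := drift_le hXi' _
          linarith
        · have h3 : D (m - y) < -(a - δ) := hL₀ _ (by push_cast at h2; rw [hy]; linarith)
          have h4 : (Set.Ioi (x + 2 * L * n)).indicator (fun _ => a - δ) m ≤ a - δ :=
            Set.indicator_le_self' (fun _ _ => by linarith) m
          linarith
    have i1 : Integrable (fun m => c * tail μ (max (x - m) t)) ν :=
      (integrable_tail_comp (by fun_prop)).const_mul c
    have i2 : Integrable (I.indicator fun _ => c₀) ν :=
      (integrable_const _).indicator measurableSet_Ioc
    have i12 : Integrable (fun m => c * tail μ (max (x - m) t) + I.indicator (fun _ => c₀) m) ν :=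
      i1.add i2
    have i3 : Integrable ((Set.Ioi (x + 2 * L * n)).indicator fun _ => a - δ) ν :=
      (integrable_const _).indicator measurableSet_Ioi
    have h5 := h0.trans (integral_mono (integrable_drift_comp hXi' (by fun_prop))
      (i12.sub i3) hpt)
    have e1 : ∫ m, (c * tail μ (max (x - m) t) + I.indicator (fun _ => c₀) m
        - (Set.Ioi (x + 2 * L * n)).indicator (fun _ => a - δ) m) ∂ν
        = c * Q + c₀ * ν.real I - (a - δ) * tail ν (x + 2 * L * n) := by
      rw [integral_sub i12 i3, integral_add i1 i2, integral_const_mul,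
        integral_indicator_const _ measurableSet_Ioc, integral_indicator_const _ measurableSet_Ioi,
        smul_eq_mul, smul_eq_mul, tail, mul_comm (ν.real I), mul_comm (a - δ)]
    have e2 : ν.real I = tail ν (x + 2 * L * j) - tail ν (x + 2 * L * (j + 1 : ℕ)) :=
      measureReal_Ioc (by push_cast; linarith)
    rw [← e2, ← e1]
    exact h5
  -- The masses of the adjacent windows telescope.
  have hsum := Finset.sum_nonneg hone
  simp only [Finset.sum_sub_distrib, Finset.sum_add_distrib, Finset.sum_const] at hsum
  rw [← Finset.mul_sum, Finset.sum_range_sub' (fun j : ℕ => tail ν (x + 2 * L * j))] at hsum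
  simp only [Finset.card_range, nsmul_eq_mul, Nat.cast_zero, mul_zero,
    add_zero] at hsum
  have hG : 0 ≤ tail ν x := tail_nonneg x
  have hG' : 0 ≤ tail ν (x + 2 * L * n) := tail_nonneg _
  have h6 : c₀ * tail ν x ≤ n * δ * tail ν x := mul_le_mul_of_nonneg_right hnδ hG
  have h7 : 0 ≤ c₀ * tail ν (x + 2 * L * n) := mul_nonneg hc₀0 hG'
  refine le_of_mul_le_mul_left (a := (n : ℝ)) ?_ (by linarith)
  linarith

/-- Take `δ = c * tail μ t` in the averaged bound. Of the three terms `C * tail μ t`, two come from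
the one-large-summand estimate with `η = tail μ t` and one from the window error. The bound at `x +
R` uses the hypothesis only up to `x`, which allows induction in steps of `R`. -/
theorem exists_shifted_tail_bound (hM : Measurable M) (hX : Measurable X) (hM' : Measurable M')
    (hind : IndepFun M X P) (hXi : Integrable X P) (hlaw : P.map M' = P.map M)
    (hstep : ∀ᵐ ω ∂P, M' ω ≤ max (M ω + X ω) 0) (ha : ∫ ω, X ω ∂P = -a) (hc : 0 < c)
    (hXtail : ∀ y, 0 ≤ y → ∫ ω, max (X ω - y) 0 ∂P ≤ c * tail μ y)
    (hμ : ∀ᵐ y ∂μ, 0 ≤ y) (hsub : IsSubexponential μ)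
    {t : ℝ} (ht : 0 ≤ t) (hta : c * tail μ t ≤ a) :
    ∃ R > 0, ∀ᶠ x in atTop, ∀ C ≥ 0,
      (∀ y, 0 ≤ y → y ≤ x → tail (P.map M) y ≤ C * tail μ y) →
      (a - c * tail μ t) * tail (P.map M) (x + R) ≤ c * tail μ x * (1 + 3 * C * tail μ t) := by
  have := Measure.isProbabilityMeasure_map hM.aemeasurable (μ := P)
  have hpt := hsub.tail_pos t
  obtain ⟨R, hR, hbound⟩ := exists_averaged_drift_bound hM hX hM' hind hXi hlaw hstep ha hc.le
    hXtail t (mul_pos hc hpt) hta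
  refine ⟨R, hR, ?_⟩
  filter_upwards [hsub.eventually_setIntegral_le hμ t hpt, eventually_ge_atTop t] with x h1 hx
    C hC hCx
  have hx0 : 0 ≤ x := ht.trans hx
  have h2 := hbound x hx0
  have h3 := mul_le_mul_of_nonneg_left (integral_tail_max_le ht hx hCx) hc.le
  have h4 := mul_le_mul_of_nonneg_left (mul_le_mul_of_nonneg_left h1 hC) hc.le
  have h5 := mul_le_mul_of_nonneg_left (hCx x hx0 le_rfl) (mul_pos hc hpt).le
  linarith

theorem exists_tail_le_mul_tail (hM : Measurable M) (hX : Measurable X) (hM' : Measurable M')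
    (hind : IndepFun M X P) (hXi : Integrable X P) (hlaw : P.map M' = P.map M)
    (hstep : ∀ᵐ ω ∂P, M' ω ≤ max (M ω + X ω) 0) (ha : ∫ ω, X ω ∂P = -a) (ha0 : 0 < a)
    (hc : 0 < c) (hXtail : ∀ y, 0 ≤ y → ∫ ω, max (X ω - y) 0 ∂P ≤ c * tail μ y)
    (hμ : ∀ᵐ y ∂μ, 0 ≤ y) (hsub : IsSubexponential μ) :
    ∃ C ≥ 0, ∀ y ≥ 0, tail (P.map M) y ≤ C * tail μ y := by
  have := Measure.isProbabilityMeasure_map hM.aemeasurable (μ := P)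
  obtain ⟨t, ht, hta⟩ : ∃ t : ℝ, 0 ≤ t ∧ tail μ t < a / (24 * c) :=
    ((eventually_ge_atTop 0).and (tendsto_tail.eventually_lt_const (by positivity))).exists
  -- The 24 lets the induction close: `a - c * tail μ t ≥ a / 2`, and `3 * c * C * tail μ t ≤ a * C
  -- / 8`; the shift by `R` costs a factor 2.
  rw [lt_div_iff₀ (by positivity)] at hta
  obtain ⟨R, hR, hev⟩ := exists_shifted_tail_bound hM hX hM' hind hXi hlaw hstep ha hc hXtail hμ
    hsub ht (by linarith)
  obtain ⟨x₀, hx₀⟩ := eventually_atTop.mp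
    (hev.and ((hsub.eventually_tail_le hμ R one_pos).and (eventually_ge_atTop 0)))
  have hx₀0 : 0 ≤ x₀ := (hx₀ x₀ le_rfl).2.2
  have hp := hsub.tail_pos (x₀ + R)
  -- The first entry gives the bound up to `x₀ + R`, where probabilities are at most 1; the second
  -- gives `c ≤ a * C / 8` for the induction step.
  set C := max (1 / tail μ (x₀ + R)) (8 * c / a) with hC
  have hC1 : 1 / tail μ (x₀ + R) ≤ C := le_max_left _ _
  have hC2 : 8 * c / a ≤ C := le_max_right _ _
  have hC0 : 0 ≤ C := le_trans (by positivity) hC2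
  have key : ∀ k : ℕ, ∀ y, 0 ≤ y → y ≤ x₀ + R + k * R → tail (P.map M) y ≤ C * tail μ y := by
    intro k
    induction k with
    | zero =>
      intro y _ hy
      have hy' : y ≤ x₀ + R := by simpa using hy
      calc tail (P.map M) y ≤ 1 := tail_le_one y
        _ = 1 / tail μ (x₀ + R) * tail μ (x₀ + R) := by field_simp
        _ ≤ C * tail μ y := mul_le_mul hC1 (tail_antitone hy') hp.le hC0
    | succ k ih =>
      intro y hy0 hy
      rcases le_or_gt y (x₀ + R) with hy1 | hy1
      · refine ih y hy0 (hy1.trans ?_)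
        have : 0 ≤ k * R := by positivity
        linarith
      · push_cast at hy
        obtain ⟨h1, h2, h3⟩ := hx₀ (y - R) (by linarith)
        have h4 := h1 C hC0 fun z hz0 hz => ih z hz0 (by linarith)
        rw [sub_add_cancel] at h2 h4
        have hF := hsub.tail_pos y
        have hF' := hsub.tail_pos (y - R)
        have hFt := hsub.tail_pos t
        have h5 : a / 2 * tail (P.map M) y ≤ (a - c * tail μ t) * tail (P.map M) y :=
          mul_le_mul_of_nonneg_right (by linarith) (tail_nonneg _)
        have h6 : c * tail μ (y - R) * (1 + 3 * C * tail μ t)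
            ≤ c * ((1 + 1) * tail μ y) * (1 + 3 * C * tail μ t) := by gcongr
        have h7 : c * (1 + 3 * C * tail μ t) ≤ a / 4 * C := by
          have e1 : c ≤ a / 8 * C := by
            rw [div_le_iff₀ ha0] at hC2
            linarith
          have e2 : C * (tail μ t * (24 * c)) ≤ C * a := mul_le_mul_of_nonneg_left hta.le hC0
          linarith
        have h8 : 2 * tail μ y * (c * (1 + 3 * C * tail μ t)) ≤ 2 * tail μ y * (a / 4 * C) :=
          mul_le_mul_of_nonneg_left h7 (by positivity)
        refine le_of_mul_le_mul_left (a := a / 2) ?_ (by positivity)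
        linarith
  refine ⟨C, hC0, fun y hy => ?_⟩
  obtain ⟨k, hk⟩ := exists_nat_ge (y / R)
  refine key k y hy ?_
  have := (div_le_iff₀ hR).mp hk
  linarith

/-- Upper half of Veraverbeke's theorem, for processes dominated by a Lindley recursion. -/
theorem asymptoticLE_of_lindley (hM : Measurable M) (hX : Measurable X) (hM' : Measurable M')
    (hind : IndepFun M X P) (hXi : Integrable X P) (hlaw : P.map M' = P.map M)
    (hstep : ∀ᵐ ω ∂P, M' ω ≤ max (M ω + X ω) 0) (ha : ∫ ω, X ω ∂P = -a) (ha0 : 0 < a)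
    (hc : 0 < c) (hXtail : ∀ y, 0 ≤ y → ∫ ω, max (X ω - y) 0 ∂P ≤ c * tail μ y)
    (hμ : ∀ᵐ y ∂μ, 0 ≤ y) (hsub : IsSubexponential μ) :
    AsymptoticLE (tail (P.map M)) fun x => c / a * tail μ x := by
  intro ε hε
  obtain ⟨C, hC0, hC⟩ := exists_tail_le_mul_tail hM hX hM' hind hXi hlaw hstep ha ha0 hc hXtail hμ
    hsub
  -- With `C` now fixed, `t → ∞` turns the constant in `exists_shifted_tail_bound` into `c / a`.
  have hlim : Tendsto (fun t => c * (1 + 3 * C * tail μ t) - c / a * (1 + ε / 2)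
      * (a - c * tail μ t)) atTop
      (𝓝 (c * (1 + 3 * C * 0) - c / a * (1 + ε / 2) * (a - c * 0))) := by
    have := tendsto_tail (μ := μ)
    exact ((this.const_mul _).const_add _ |>.const_mul _).sub
      (((this.const_mul _).const_sub _).const_mul _)
  have hlt : c * (1 + 3 * C * 0) - c / a * (1 + ε / 2) * (a - c * 0) < 0 := by
    have : c * (1 + 3 * C * 0) - c / a * (1 + ε / 2) * (a - c * 0) = -(c * ε / 2) := by
      field_simp
      ring
    rw [this]
    exact neg_lt_zero.mpr (by positivity)
  obtain ⟨t, ht, h1, h2⟩ := ((eventually_ge_atTop 0).and ((hlim.eventually_lt_const hlt).and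
    (tendsto_tail.eventually_lt_const (show 0 < a / c by positivity)) : ∀ᶠ t in atTop,
      _ ∧ tail μ t < a / c)).exists
  rw [lt_div_iff₀ hc] at h2
  obtain ⟨R, hR, hev⟩ := exists_shifted_tail_bound hM hX hM' hind hXi hlaw hstep ha hc hXtail hμ
    hsub ht (by linarith)
  -- Chosen so that `(1 + ε / 2) * (1 + ε / (2 + ε)) = 1 + ε`.
  have hε' : 0 < ε / (2 + ε) := by positivity
  have hshift := (hev.and (hsub.eventually_tail_le hμ R hε'))
  filter_upwards [(tendsto_atTop_add_const_right atTop (-R) tendsto_id).eventually hshift]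
    with x hx
  obtain ⟨h3, h4⟩ := hx
  simp only [id, neg_add_cancel_right] at h3 h4
  have h5 := h3 C hC0 fun y hy _ => hC y hy
  have hpos : 0 < a - c * tail μ t := by linarith
  have hF := hsub.tail_pos (x + -R)
  have h6 : (a - c * tail μ t) * tail (P.map M) x
      ≤ (a - c * tail μ t) * (c / a * (1 + ε / 2) * tail μ (x + -R)) := by
    refine h5.trans ?_
    have := mul_le_mul_of_nonneg_left (sub_neg.mp h1).le hF.le
    linarith
  have h7 := le_of_mul_le_mul_left h6 hpos
  calc tail (P.map M) x ≤ c / a * (1 + ε / 2) * tail μ (x + -R) := h7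
    _ ≤ c / a * (1 + ε / 2) * ((1 + ε / (2 + ε)) * tail μ x) := by gcongr
    _ = (1 + ε) * (c / a * tail μ x) := by field_simp; ring

end Upper

/-! ### Order statistics -/

section OrderStat

variable {n k : ℕ}

theorem le_orderStat (hk : 1 ≤ k) (hkn : k ≤ n) {x : Fin n → ℝ} {t : ℝ} (s : Finset (Fin n))
    (hs : s.card < k) (h : ∀ i ∉ s, t ≤ x i) : t ≤ orderStat k x := by
  by_contra! hlt
  have h1 := (orderStat_le_iff hk hkn x _).mp le_rfl
  have h2 : (Finset.univ.filter fun i => x i ≤ orderStat k x) ⊆ s := fun i hi => by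
    by_contra his
    exact absurd (h i his) (not_le.mpr ((Finset.mem_filter.mp hi).2.trans_lt hlt))
  have := Finset.card_le_card h2
  omega

theorem orderStat_nonneg (hk : 1 ≤ k) (hkn : k ≤ n) {x : Fin n → ℝ} (h : ∀ i, 0 ≤ x i) :
    0 ≤ orderStat k x :=
  le_orderStat hk hkn ∅ (by rw [Finset.card_empty]; omega) fun i _ => h i

theorem orderStat_le_of_forall_le (hk : 1 ≤ k) (hkn : k ≤ n) {x : Fin n → ℝ} {t : ℝ}
    (h : ∀ i, x i ≤ t) : orderStat k x ≤ t := by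
  rw [orderStat_le_iff hk hkn, Finset.filter_true_of_mem fun i _ => h i]
  simpa using hkn

theorem orderStat_add_le (hk : 1 ≤ k) (hkn : k ≤ n) {x b : Fin n → ℝ} {t : ℝ}
    (h : ∀ i, x i ≤ t) : orderStat k (fun i => x i + b i) ≤ t + orderStat k b := by
  rw [orderStat_le_iff hk hkn]
  refine ((orderStat_le_iff hk hkn b _).mp le_rfl).trans (Finset.card_le_card fun i hi => ?_)
  simp only [Finset.mem_filter, Finset.mem_univ, true_and] at hi ⊢
  exact add_le_add (h i) hi

theorem orderStat_le_apply_sort (hk : 1 ≤ k) (hkn : k ≤ n) (b : Fin n → ℝ) {j : Fin n}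
    (hj : k - 1 ≤ j) : orderStat k b ≤ b (Tuple.sort b j) := by
  rw [orderStat_le_iff hk hkn]
  calc k ≤ (Finset.Iic j).card := by rw [Fin.card_Iic]; omega
    _ = ((Finset.Iic j).map (Tuple.sort b).toEmbedding).card := (Finset.card_map _).symm
    _ ≤ _ := Finset.card_le_card fun i hi => by
      obtain ⟨i', hi', rfl⟩ := Finset.mem_map.mp hi
      simp only [Finset.mem_filter, Finset.mem_univ, true_and]
      exact Tuple.monotone_sort b (Finset.mem_Iic.mp hi')

theorem measurable_orderStat (hk : 1 ≤ k) (hkn : k ≤ n) :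
    Measurable (orderStat k : (Fin n → ℝ) → ℝ) := by
  refine measurable_of_Iic fun t => ?_
  have : orderStat k ⁻¹' Set.Iic t = {x : Fin n → ℝ | (k : ℝ) ≤ ∑ i,
      (Set.Iic t).indicator (fun _ => (1 : ℝ)) (x i)} := by
    ext x
    rw [Set.mem_preimage, Set.mem_Iic, orderStat_le_iff hk hkn, Finset.card_filter,
      Set.mem_ofPred_eq]
    simp only [Set.indicator_apply, Set.mem_Iic]
    norm_cast
  rw [this]
  refine measurableSet_le measurable_const (Finset.measurable_sum _ fun i _ => ?_)
  exact (measurable_const.indicator measurableSet_Iic).comp (measurable_pi_apply i)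

/-- `Tuple.sort` breaks ties by index, so the event is described by finitely many comparisons of
coordinates. -/
theorem measurableSet_sort_eq (σ : Equiv.Perm (Fin n)) :
    MeasurableSet {b : Fin n → ℝ | Tuple.sort b = σ} := by
  have : {b : Fin n → ℝ | Tuple.sort b = σ} = {b | (∀ i j, i ≤ j → b (σ i) ≤ b (σ j)) ∧
      ∀ i j, i < j → b (σ i) = b (σ j) → σ i < σ j} := by
    ext b
    rw [Set.mem_ofPred_eq, eq_comm, Tuple.eq_sort_iff]
    rfl
  rw [this]
  simp only [Set.ofPred_and, Set.ofPred_forall]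
  refine MeasurableSet.inter ?_ ?_
  · exact .iInter fun i => .iInter fun j => .iInter fun _ =>
      measurableSet_le (by fun_prop) (by fun_prop)
  · refine .iInter fun i => .iInter fun j => .iInter fun _ => ?_
    by_cases h : σ i < σ j
    · simp [h]
    · simp only [h, imp_false]
      exact (measurableSet_eq_fun (by fun_prop) (by fun_prop)).compl

end OrderStat

/-! ### Comparison of the dynamics with Lindley recursions -/

section Dynamics

variable {N nF nJ : ℕ}

theorem workloadAfterArrival_apply (v : Fin N → ℝ) (s : Fin nF ↪ Fin N) (b : Fin nF → ℝ)
    (l : Fin nF) : workloadAfterArrival nJ v s b (s l)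
      = max (v (s l)) (min (v (s l) + b l) (responseTime nJ v s b)) := by
  have h : ∃ l', s l' = s l := ⟨l, rfl⟩
  rw [workloadAfterArrival, dif_pos h, s.injective h.choose_spec]

theorem workloadAfterArrival_of_notMem (v : Fin N → ℝ) (s : Fin nF ↪ Fin N) (b : Fin nF → ℝ)
    {i : Fin N} (h : ¬∃ l, s l = i) : workloadAfterArrival nJ v s b i = v i := by
  rw [workloadAfterArrival, dif_neg h]

theorem le_workloadAfterArrival (v : Fin N → ℝ) (s : Fin nF ↪ Fin N) (b : Fin nF → ℝ)
    (i : Fin N) : v i ≤ workloadAfterArrival nJ v s b i := by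
  by_cases h : ∃ l, s l = i
  · obtain ⟨l, rfl⟩ := h
    rw [workloadAfterArrival_apply]
    exact le_max_left _ _
  · rw [workloadAfterArrival_of_notMem v s b h]

theorem nextWorkload_le (hJ : 1 ≤ nJ) (hJF : nJ ≤ nF) {v : Fin N → ℝ} (s : Fin nF ↪ Fin N)
    {b : Fin nF → ℝ} (hb : ∀ l, 0 ≤ b l) (a : ℝ) {M : ℝ} (hM : ∀ i, v i ≤ M) (i : Fin N) :
    nextWorkload nJ v s b a i ≤ max (M + (orderStat nJ b - a)) 0 := by
  have hb0 := orderStat_nonneg hJ hJF hb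
  have hW : workloadAfterArrival nJ v s b i ≤ M + orderStat nJ b := by
    by_cases h : ∃ l, s l = i
    · obtain ⟨l, rfl⟩ := h
      rw [workloadAfterArrival_apply]
      exact max_le (by linarith [hM (s l)])
        ((min_le_right _ _).trans (orderStat_add_le hJ hJF fun l => hM (s l)))
    · rw [workloadAfterArrival_of_notMem v s b h]
      linarith [hM i]
  exact max_le_max_right _ (by linarith)

theorem waitingTime_le (hJ : 1 ≤ nJ) (hJF : nJ ≤ nF) {v : Fin N → ℝ} (s : Fin nF ↪ Fin N) {M : ℝ}
    (hM : ∀ i, v i ≤ M) : waitingTime nJ v s ≤ M :=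
  orderStat_le_of_forall_le hJ hJF fun l => hM (s l)

theorem card_filter_val_lt_lt (hJ : 1 ≤ nJ) (hJF : nJ ≤ nF) :
    (Finset.univ.filter fun l : Fin nF => ¬nJ - 1 ≤ l.val).card < nJ := by
  have h : (Finset.univ.filter fun l : Fin nF => ¬nJ - 1 ≤ l.val)
      = Finset.Iio ⟨nJ - 1, by omega⟩ := by
    ext l
    simp [Fin.lt_def]
    omega
  rw [h, Fin.card_Iio]
  simp only
  omega

theorem le_waitingTime (hJ : 1 ≤ nJ) (hJF : nJ ≤ nF) {v : Fin N → ℝ} (s : Fin nF ↪ Fin N) {m : ℝ}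
    (hm : ∀ l : Fin nF, nJ - 1 ≤ l.val → m ≤ v (s l)) : m ≤ waitingTime nJ v s :=
  le_orderStat hJ hJF _ (card_filter_val_lt_lt hJ hJF) fun l hl => hm l (by simpa using hl)

/-- The assignments that send, in the order given by the permutation `σ`, the first `k` replicas to
the same servers as `s` does, and the other replicas to the other servers in the range of `s`. -/
def matchingAssignments (k : ℕ) (s : Fin nF ↪ Fin N) (σ : Equiv.Perm (Fin nF)) :
    Finset (Fin nF ↪ Fin N) :=
  Finset.univ.image fun τ : Equiv.Perm {l : Fin nF // k ≤ l.val} =>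
    (σ⁻¹.trans (Equiv.Perm.ofSubtype τ)).toEmbedding.trans s

theorem card_matchingAssignments (k : ℕ) (s : Fin nF ↪ Fin N) (σ : Equiv.Perm (Fin nF)) :
    (matchingAssignments k s σ).card = (nF - k)! := by
  rw [matchingAssignments, Finset.card_image_of_injective, Finset.card_univ, Fintype.card_perm]
  · congr 1
    rw [Fintype.card_subtype]
    rcases lt_or_ge k nF with h | h
    · have : (Finset.univ.filter fun l : Fin nF => k ≤ l.val) = Finset.Ici ⟨k, h⟩ := by
        ext l
        simp [Fin.le_def]
      rw [this, Fin.card_Ici]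
    · rw [Finset.filter_false_of_mem fun l _ => by omega, Finset.card_empty]
      omega
  · intro τ τ' h
    refine Equiv.Perm.ofSubtype_injective (Equiv.ext fun l => s.injective ?_)
    simpa using DFunLike.congr_fun h (σ l)

/-- Every server in the minimum receives a replica of size at least `B_(nJ)` starting no earlier
than `m`. Cancellation does not shorten it below `m + B_(nJ)`, because only `nJ - 1` replicas can
complete before that time. -/
theorem le_workloadAfterArrival_of_matching (hJ : 1 ≤ nJ) (hJF : nJ ≤ nF) {v : Fin N → ℝ}
    {s e : Fin nF ↪ Fin N} {b : Fin nF → ℝ} {m : ℝ}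
    (he : e ∈ matchingAssignments (nJ - 1) s (Tuple.sort b))
    (hm : ∀ l : Fin nF, nJ - 1 ≤ l.val → m ≤ v (s l)) {l : Fin nF} (hl : nJ - 1 ≤ l.val) :
    m + orderStat nJ b ≤ workloadAfterArrival nJ v e b (s l) := by
  obtain ⟨τ, -, rfl⟩ := Finset.mem_image.mp he
  set e := ((Tuple.sort b)⁻¹.trans (Equiv.Perm.ofSubtype τ)).toEmbedding.trans s with hedef
  have heσ : ∀ j, e (Tuple.sort b j) = s (Equiv.Perm.ofSubtype τ j) := fun j => by
    simp [hedef]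
  -- The exceptional set consists of the `nJ - 1` smallest replicas; positions in the sorted order
  -- count from `0`.
  have hR : m + orderStat nJ b ≤ responseTime nJ v e b := by
    refine le_orderStat hJ hJF ((Finset.univ.filter fun l : Fin nF => ¬nJ - 1 ≤ l.val).map
      (Tuple.sort b).toEmbedding) (by
        rw [Finset.card_map]; exact card_filter_val_lt_lt hJ hJF) fun i hi => ?_
    obtain ⟨j, rfl⟩ := (Tuple.sort b).surjective i
    have hj : nJ - 1 ≤ j.val := by
      by_contra hj
      exact hi (Finset.mem_map.mpr ⟨j, by simpa using hj, rfl⟩)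
    refine add_le_add ?_ (orderStat_le_apply_sort hJ hJF b hj)
    rw [replicaWait, heσ, Equiv.Perm.ofSubtype_apply_of_mem τ hj]
    exact hm _ (τ ⟨j, hj⟩).2
  obtain ⟨j, hj⟩ := τ.surjective ⟨l, hl⟩
  have hel : e (Tuple.sort b j) = s l := by
    rw [heσ, Equiv.Perm.ofSubtype_apply_coe, hj]
  rw [← hel, workloadAfterArrival_apply]
  refine le_max_of_le_right (le_min (add_le_add ?_ (orderStat_le_apply_sort hJ hJF b j.2)) hR)
  rw [hel]
  exact hm l hl

open Classical in
theorem le_nextWorkload (hJ : 1 ≤ nJ) (hJF : nJ ≤ nF) {v : Fin N → ℝ}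
    {s e : Fin nF ↪ Fin N} {b : Fin nF → ℝ} (a : ℝ) {m : ℝ}
    (hm : ∀ l : Fin nF, nJ - 1 ≤ l.val → m ≤ v (s l)) {l : Fin nF} (hl : nJ - 1 ≤ l.val) :
    m + ((if e ∈ matchingAssignments (nJ - 1) s (Tuple.sort b) then orderStat nJ b else 0) - a)
      ≤ nextWorkload nJ v e b a (s l) := by
  refine le_max_of_le_left ?_
  split_ifs with he
  · have := le_workloadAfterArrival_of_matching hJ hJF he hm hl
    linarith
  · have := (hm l hl).trans (le_workloadAfterArrival (nJ := nJ) v e b (s l))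
    linarith

end Dynamics

/-! ### Measurability of the dynamics -/

section Measurability

variable {N nF nJ : ℕ}

instance : DiscreteMeasurableSpace (Fin nF ↪ Fin N) :=
  inferInstanceAs (@DiscreteMeasurableSpace _ ⊤)

theorem measurable_waitingTime (hJ : 1 ≤ nJ) (hJF : nJ ≤ nF) (s : Fin nF ↪ Fin N) :
    Measurable fun v : Fin N → ℝ => waitingTime nJ v s :=
  (measurable_orderStat hJ hJF).comp (measurable_pi_lambda _ fun l => measurable_pi_apply (s l))

theorem measurable_nextWorkload (hJ : 1 ≤ nJ) (hJF : nJ ≤ nF) :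
    Measurable fun p : (Fin N → ℝ) × ℝ × (Fin nF → ℝ) × (Fin nF ↪ Fin N) =>
      nextWorkload nJ p.1 p.2.2.2 p.2.2.1 p.2.1 := by
  have h : ∀ s : Fin nF ↪ Fin N, Measurable fun q : (Fin N → ℝ) × ℝ × (Fin nF → ℝ) =>
      nextWorkload nJ q.1 s q.2.2 q.2.1 := by
    refine fun s => measurable_pi_lambda _ fun i => ?_
    have hR : Measurable fun q : (Fin N → ℝ) × ℝ × (Fin nF → ℝ) =>
        responseTime nJ q.1 s q.2.2 :=
      (measurable_orderStat hJ hJF).comp (measurable_pi_lambda _ fun l => by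
        unfold replicaWait; fun_prop)
    refine Measurable.max ?_ measurable_const
    by_cases hi : ∃ l, s l = i
    · obtain ⟨l, rfl⟩ := hi
      simp only [workloadAfterArrival_apply]
      fun_prop
    · simp only [workloadAfterArrival_of_notMem _ _ _ hi]
      fun_prop
  have h' : Measurable fun q : ((Fin N → ℝ) × ℝ × (Fin nF → ℝ)) × (Fin nF ↪ Fin N) =>
      nextWorkload nJ q.1.1 q.2 q.1.2.2 q.1.2.1 :=
    measurable_from_prod_countable_left h
  exact h'.comp (f := fun p : (Fin N → ℝ) × ℝ × (Fin nF → ℝ) × (Fin nF ↪ Fin N) =>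
    ((p.1, p.2.1, p.2.2.1), p.2.2.2)) (by fun_prop)

/-- The workloads are a measurable function of the initial workloads and the earlier jobs. -/
theorem exists_workload_eq (hJ : 1 ≤ nJ) (hJF : nJ ≤ nF) {Ω : Type*} (V₀ : Ω → Fin N → ℝ)
    (A : ℕ → Ω → ℝ) (B : ℕ → Ω → Fin nF → ℝ) (S : ℕ → Ω → (Fin nF ↪ Fin N)) (n : ℕ) :
    ∃ g : (Fin N → ℝ) × (Finset.range n → ℝ × (Fin nF → ℝ) × (Fin nF ↪ Fin N)) → Fin N → ℝ,
      Measurable g ∧ ∀ ω, workload nJ V₀ A B S n ω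
        = g (V₀ ω, fun i => (A i ω, B i ω, S i ω)) := by
  induction n with
  | zero => exact ⟨Prod.fst, measurable_fst, fun ω => rfl⟩
  | succ n ih =>
    obtain ⟨g, hg, hgw⟩ := ih
    refine ⟨fun p => nextWorkload nJ
      (g (p.1, fun i => p.2 ⟨i, Finset.range_subset_range.mpr n.le_succ i.2⟩))
      (p.2 ⟨n, Finset.self_mem_range_succ n⟩).2.2 (p.2 ⟨n, Finset.self_mem_range_succ n⟩).2.1
      (p.2 ⟨n, Finset.self_mem_range_succ n⟩).1, ?_, fun ω => ?_⟩
    · refine (measurable_nextWorkload hJ hJF).comp (f := fun p : (Fin N → ℝ) ×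
        (Finset.range (n + 1) → ℝ × (Fin nF → ℝ) × (Fin nF ↪ Fin N)) =>
        (g (p.1, fun i => p.2 ⟨i, Finset.range_subset_range.mpr n.le_succ i.2⟩),
          p.2 ⟨n, Finset.self_mem_range_succ n⟩)) ?_
      refine (hg.comp ?_).prodMk (by fun_prop)
      exact measurable_fst.prodMk (measurable_pi_lambda _ fun i => by fun_prop)
    · rw [workload, hgw]

end Measurability

/-! ### Asymptotics of the waiting time -/

section Probability

theorem indepFun_prodMk_of_indepFun {Ω α β γ : Type*} [MeasurableSpace Ω] [MeasurableSpace α]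
    [MeasurableSpace β] [MeasurableSpace γ] {P : Measure Ω} [IsProbabilityMeasure P] {X : Ω → α}
    {Y : Ω → β} {Z : Ω → γ} (hX : Measurable X) (hY : Measurable Y) (hZ : Measurable Z)
    (h : IndepFun X (fun ω => (Y ω, Z ω)) P) (h' : IndepFun Y Z P) :
    IndepFun (fun ω => (X ω, Y ω)) Z P := by
  have hXY : IndepFun X Y P := h.comp measurable_id measurable_fst
  have := Measure.isProbabilityMeasure_map hX.aemeasurable (μ := P)
  have := Measure.isProbabilityMeasure_map hY.aemeasurable (μ := P)
  have := Measure.isProbabilityMeasure_map hZ.aemeasurable (μ := P)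
  rw [indepFun_iff_map_prod_eq_prod_map_map (by fun_prop) (by fun_prop)] at *
  rw [hXY, ← MeasurableEquiv.map_measurableEquiv_injective MeasurableEquiv.prodAssoc |>.eq_iff,
    Measure.prodAssoc_prod, ← h', ← h, Measure.map_map (by fun_prop) (by fun_prop)]
  rfl

variable {Ω : Type*} [MeasurableSpace Ω] {P : Measure Ω}
  {N nF nJ : ℕ} {V₀ : Ω → Fin N → ℝ} {A : ℕ → Ω → ℝ} {B : ℕ → Ω → Fin nF → ℝ}
  {S : ℕ → Ω → (Fin nF ↪ Fin N)}

theorem IsInput.measurable_job (h : IsInput P A B S) (n : ℕ) :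
    Measurable fun ω => (A n ω, B n ω, S n ω) :=
  (h.measurable_A n).prodMk ((h.measurable_B n).prodMk (h.measurable_S n))

theorem IsInput.measurable_workload (h : IsInput P A B S) (hV : Measurable V₀) (hJ : 1 ≤ nJ)
    (hJF : nJ ≤ nF) (n : ℕ) : Measurable (workload nJ V₀ A B S n) := by
  obtain ⟨g, hg, hgw⟩ := exists_workload_eq hJ hJF V₀ A B S n
  rw [funext hgw]
  exact hg.comp (hV.prodMk (measurable_pi_lambda _ fun i => h.measurable_job i))

theorem workload_one {Ω : Type*} (V₀ : Ω → Fin N → ℝ) (A : ℕ → Ω → ℝ) (B : ℕ → Ω → Fin nF → ℝ)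
    (S : ℕ → Ω → (Fin nF ↪ Fin N)) (ω : Ω) :
    workload nJ V₀ A B S 1 ω = nextWorkload nJ (V₀ ω) (S 0 ω) (B 0 ω) (A 0 ω) := rfl

open Classical in
theorem measurable_ite_mem_matchingAssignments (k : ℕ) (s e : Fin nF ↪ Fin N)
    {f : (Fin nF → ℝ) → ℝ} (hf : Measurable f) :
    Measurable fun b => if e ∈ matchingAssignments k s (Tuple.sort b) then f b else 0 := by
  refine Measurable.ite ?_ hf measurable_const
  have : {b : Fin nF → ℝ | e ∈ matchingAssignments k s (Tuple.sort b)}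
      = ⋃ σ ∈ {σ | e ∈ matchingAssignments k s σ}, {b | Tuple.sort b = σ} := by
    ext b
    simp
  rw [this]
  exact MeasurableSet.biUnion (Set.to_countable _) fun σ _ => measurableSet_sort_eq σ

open Classical in
theorem measurable_thinned (k : ℕ) (s : Fin nF ↪ Fin N) {f : (Fin nF → ℝ) → ℝ}
    (hf : Measurable f) :
    Measurable fun z : (Fin nF → ℝ) × (Fin nF ↪ Fin N) =>
      if z.2 ∈ matchingAssignments k s (Tuple.sort z.1) then f z.1 else 0 :=
  measurable_from_prod_countable_left fun e => measurable_ite_mem_matchingAssignments k s e hf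

open Classical in
theorem integrable_thinned (h : IsInput P A B S) (k : ℕ) (s : Fin nF ↪ Fin N)
    {f : (Fin nF → ℝ) → ℝ} (hf : Measurable f) (hfi : Integrable (fun ω => f (B 0 ω)) P) :
    Integrable (fun ω => if S 0 ω ∈ matchingAssignments k s (Tuple.sort (B 0 ω))
      then f (B 0 ω) else 0) P := by
  refine hfi.mono ((measurable_thinned k s hf).comp
    ((h.measurable_B 0).prodMk (h.measurable_S 0))).aestronglyMeasurable
    (Eventually.of_forall fun ω => ?_)
  split_ifs <;> simp

theorem IsSteadyState.measureReal_eq (hJ : 1 ≤ nJ) (hJF : nJ ≤ nF) (h : IsInput P A B S)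
    (hs : IsSteadyState P nJ V₀ A B S) (n : ℕ) {E : Set (Fin N → ℝ)} (hE : MeasurableSet E) :
    P.real {ω | workload nJ V₀ A B S n ω ∈ E} = P.real {ω | V₀ ω ∈ E} := by
  have := congrArg (fun μ : Measure _ => μ.real E) (hs.stationary n)
  simp only [map_measureReal_apply (h.measurable_workload hs.measurable_init hJ hJF n) hE,
    map_measureReal_apply hs.measurable_init hE] at this
  exact this

theorem IsSteadyState.map_comp_eq (hJ : 1 ≤ nJ) (hJF : nJ ≤ nF) (h : IsInput P A B S)
    (hs : IsSteadyState P nJ V₀ A B S) (n : ℕ) {f : (Fin N → ℝ) → ℝ} (hf : Measurable f) :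
    P.map (fun ω => f (workload nJ V₀ A B S n ω)) = P.map (fun ω => f (V₀ ω)) := by
  have := congrArg (Measure.map f) (hs.stationary n)
  rwa [Measure.map_map hf (h.measurable_workload hs.measurable_init hJ hJF n),
    Measure.map_map hf hs.measurable_init] at this

theorem card_embedding_eq_thinning_mul (hJ : 1 ≤ nJ) (hJF : nJ ≤ nF) :
    (Fintype.card (Fin nF ↪ Fin N) : ℝ) = thinning N nF nJ * ((nF - (nJ - 1))! : ℝ) := by
  rw [Fintype.card_embedding_eq, Fintype.card_fin, Fintype.card_fin,
    Nat.descFactorial_eq_factorial_mul_choose, thinning,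
    show nF - (nJ - 1) = nF - nJ + 1 by omega]
  have : ((nF - nJ + 1)! : ℝ) ≠ 0 := Nat.cast_ne_zero.mpr (Nat.factorial_ne_zero _)
  push_cast
  field_simp

/-- The inverse of `K` is the proportion of matching assignments among all assignments. This gives
`ρL ≤ ρU`, so stability carries over to the thinned recursion. -/
theorem one_le_thinning (hJ : 1 ≤ nJ) (hJF : nJ ≤ nF) (hFN : nF ≤ N) :
    1 ≤ thinning N nF nJ := by
  have h1 := Finset.card_le_univ (matchingAssignments (nJ - 1) (Fin.castLEEmb hFN) 1)
  rw [card_matchingAssignments] at h1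
  have h2 : ((nF - (nJ - 1))! : ℝ) ≤ Fintype.card (Fin nF ↪ Fin N) := by exact_mod_cast h1
  rw [card_embedding_eq_thinning_mul hJ hJF] at h2
  have h3 : (0 : ℝ) < ((nF - (nJ - 1))! : ℝ) := Nat.cast_pos.mpr (Nat.factorial_pos _)
  exact le_of_mul_le_mul_right (by linarith) h3

open Classical in
/-- Given the replica sizes, the assignment matches with probability `1 / K`. -/
theorem integral_thinned (hJ : 1 ≤ nJ) (hJF : nJ ≤ nF) (h : IsInput P A B S)
    (s : Fin nF ↪ Fin N) {f : (Fin nF → ℝ) → ℝ} (hf : Measurable f)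
    (hfi : Integrable (fun ω => f (B 0 ω)) P) :
    ∫ ω, (if S 0 ω ∈ matchingAssignments (nJ - 1) s (Tuple.sort (B 0 ω))
      then f (B 0 ω) else 0) ∂P = (∫ ω, f (B 0 ω) ∂P) / thinning N nF nJ := by
  set g : (Fin nF ↪ Fin N) → (Fin nF → ℝ) → ℝ := fun e b =>
    if e ∈ matchingAssignments (nJ - 1) s (Tuple.sort b) then f b else 0 with hg
  have hgm : ∀ e, Measurable (g e) := fun e =>
    measurable_ite_mem_matchingAssignments (nJ - 1) s e hf
  have hgi : ∀ e, Integrable (fun ω => g e (B 0 ω)) P := fun e => by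
    refine hfi.mono ((hgm e).comp (h.measurable_B 0)).aestronglyMeasurable
      (Eventually.of_forall fun ω => ?_)
    simp only [hg]
    split_ifs <;> simp
  set c : ℝ := (Fintype.card (Fin nF ↪ Fin N) : ℝ) with hc
  have hprob : ∀ e, ∫ ω, ({e} : Set (Fin nF ↪ Fin N)).indicator (fun _ => (1 : ℝ)) (S 0 ω) ∂P
      = c⁻¹ := fun e => by
    have : (fun ω => ({e} : Set (Fin nF ↪ Fin N)).indicator (fun _ => (1 : ℝ)) (S 0 ω))
        = {ω | S 0 ω = e}.indicator fun _ => 1 := by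
      ext ω
      simp [Set.indicator_apply]
    rw [this, integral_indicator_const _ (show MeasurableSet {ω | S 0 ω = e} from
      h.measurable_S 0 (.singleton e)), measureReal_def,
      h.law_S]
    simp [hc]
  have hind : ∀ e, ∫ ω, g e (B 0 ω)
      * ({e} : Set (Fin nF ↪ Fin N)).indicator (fun _ => (1 : ℝ)) (S 0 ω) ∂P
      = (∫ ω, g e (B 0 ω) ∂P) * c⁻¹ := fun e => by
    rw [← hprob e]
    exact ((h.indep_B_S 0).comp (hgm e)
      (Measurable.of_discrete (f := ({e} : Set (Fin nF ↪ Fin N)).indicator fun _ => (1 : ℝ)))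
      ).integral_fun_mul_eq_mul_integral
      ((hgm e).comp (h.measurable_B 0)).aestronglyMeasurable
      (Measurable.of_discrete.comp (h.measurable_S 0)).aestronglyMeasurable
  have hsum : ∀ ω, g (S 0 ω) (B 0 ω) = ∑ e, g e (B 0 ω)
      * ({e} : Set (Fin nF ↪ Fin N)).indicator (fun _ => (1 : ℝ)) (S 0 ω) := fun ω => by
    simp [Set.indicator_apply]
  -- The number of matching assignments does not depend on the order of the sizes, so the matching
  -- event is independent of the sizes although it refers to their order.
  have hcard : ∀ ω, ∑ e, g e (B 0 ω) = ((nF - (nJ - 1))! : ℝ) * f (B 0 ω) := fun ω => by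
    simp only [hg]
    rw [Finset.sum_ite_mem, Finset.univ_inter, Finset.sum_const, card_matchingAssignments,
      nsmul_eq_mul]
  calc ∫ ω, g (S 0 ω) (B 0 ω) ∂P = ∑ e, (∫ ω, g e (B 0 ω) ∂P) * c⁻¹ := by
        simp_rw [hsum]
        rw [integral_finsetSum]
        · exact Finset.sum_congr rfl fun e _ => hind e
        · intro e _
          refine (hgi e).mul_bdd (c := 1) ((Measurable.of_discrete
            (f := ({e} : Set (Fin nF ↪ Fin N)).indicator fun _ => (1 : ℝ))).comp
            (h.measurable_S 0)).aestronglyMeasurable (Eventually.of_forall fun ω => ?_)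
          simp only [Set.indicator_apply]
          split_ifs <;> simp
    _ = (∫ ω, f (B 0 ω) ∂P) / thinning N nF nJ := by
        rw [← Finset.sum_mul, ← integral_finsetSum _ fun e _ => hgi e]
        simp_rw [hcard]
        rw [integral_const_mul, hc, card_embedding_eq_thinning_mul hJ hJF]
        have : ((nF - (nJ - 1))! : ℝ) ≠ 0 := Nat.cast_ne_zero.mpr (Nat.factorial_ne_zero _)
        field_simp

variable [IsProbabilityMeasure P]

theorem indepFun_workload_job (hJ : 1 ≤ nJ) (hJF : nJ ≤ nF) (h : IsInput P A B S)
    (hs : IsSteadyState P nJ V₀ A B S) (n : ℕ) :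
    IndepFun (workload nJ V₀ A B S n) (fun ω => (A n ω, B n ω, S n ω)) P := by
  obtain ⟨g, hg, hgw⟩ := exists_workload_eq hJ hJF V₀ A B S n
  have hpast := h.indep_jobs.indepFun_finset (Finset.range n) {n} (by simp) h.measurable_job
  have hpast' : IndepFun (fun ω (i : Finset.range n) => (A i ω, B i ω, S i ω))
      (fun ω => (A n ω, B n ω, S n ω)) P :=
    hpast.comp measurable_id (measurable_pi_apply (⟨n, Finset.mem_singleton_self n⟩ :
      ({n} : Finset ℕ)))
  have hinit : IndepFun V₀ (fun ω => ((fun i : Finset.range n => (A i ω, B i ω, S i ω)),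
      (A n ω, B n ω, S n ω))) P :=
    hs.indep_init.comp (ψ := fun z : ℕ → ℝ × (Fin nF → ℝ) × (Fin nF ↪ Fin N) =>
      ((fun i : Finset.range n => z i), z n)) measurable_id (by fun_prop)
  have := indepFun_prodMk_of_indepFun hs.measurable_init
    (measurable_pi_lambda _ fun i : Finset.range n => h.measurable_job i) (h.measurable_job n)
    hinit hpast'
  rw [funext hgw]
  exact this.comp hg measurable_id

/-- The upper half of the theorem, with the residual law described by its tail. -/
theorem asymptoticLE_waitingTime_upper (hJ : 1 ≤ nJ) (hJF : nJ ≤ nF) (hFN : nF ≤ N)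
    (h : IsInput P A B S) (hs : IsSteadyState P nJ V₀ A B S)
    (hBint : Integrable (fun ω => orderStat nJ (B 0 ω)) P)
    (hB0 : 0 < ∫ ω, orderStat nJ (B 0 ω) ∂P)
    (hBA : ∫ ω, orderStat nJ (B 0 ω) ∂P < ∫ ω, A 0 ω ∂P)
    {μ : Measure ℝ} [IsProbabilityMeasure μ] (hμ : ∀ᵐ y ∂μ, 0 ≤ y)
    (htail : ∀ y, 0 ≤ y → ∫ ω, max (orderStat nJ (B 0 ω) - y) 0 ∂P
      = (∫ ω, orderStat nJ (B 0 ω) ∂P) * tail μ y)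
    (hsub : IsSubexponential μ) (n : ℕ) :
    AsymptoticLE
      (fun x => P.real {ω | x < waitingTime nJ (workload nJ V₀ A B S n ω) (S n ω)})
      (fun x => (∫ ω, orderStat nJ (B 0 ω) ∂P) /
        (∫ ω, A 0 ω ∂P - ∫ ω, orderStat nJ (B 0 ω) ∂P) * tail μ x) := by
  have : Nonempty (Fin N) := ⟨⟨0, by omega⟩⟩
  have hle : ∀ (v : Fin N → ℝ) i, v i ≤ ⨆ i, v i := fun v i =>
    le_ciSup (Set.finite_range v).bddAbove i
  have hsup : Measurable fun v : Fin N → ℝ => ⨆ i, v i :=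
    Measurable.iSup fun i => measurable_pi_apply i
  have hos := measurable_orderStat hJ hJF
  have hV := hs.measurable_init
  have hAm := h.measurable_A 0
  have hBm := h.measurable_B 0
  have hind := (indepFun_workload_job hJ hJF h hs 0).comp
    (ψ := fun z : ℝ × (Fin nF → ℝ) × (Fin nF ↪ Fin N) => orderStat nJ z.2.1 - z.1)
    hsup (by fun_prop)
  have key := asymptoticLE_of_lindley (P := P) (M := fun ω => ⨆ i, V₀ ω i)
    (X := fun ω => orderStat nJ (B 0 ω) - A 0 ω)
    (M' := fun ω => ⨆ i, workload nJ V₀ A B S 1 ω i) (μ := μ)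
    (c := ∫ ω, orderStat nJ (B 0 ω) ∂P)
    (a := ∫ ω, A 0 ω ∂P - ∫ ω, orderStat nJ (B 0 ω) ∂P)
    (hsup.comp hV) (by fun_prop) (hsup.comp (h.measurable_workload hV hJ hJF 1)) hind
    (hBint.sub h.integrable_A) (hs.map_comp_eq hJ hJF h 1 hsup) ?_
    (by rw [integral_sub hBint h.integrable_A]; ring) (sub_pos.mpr hBA) hB0 ?_ hμ hsub
  · intro ε hε
    filter_upwards [key ε hε] with x hx
    refine le_trans ?_ hx
    have e : tail (P.map fun ω => ⨆ i, V₀ ω i) x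
        = P.real {ω | x < ⨆ i, workload nJ V₀ A B S n ω i} := by
      rw [← hs.map_comp_eq hJ hJF h n hsup, tail, map_measureReal_apply
        (by exact hsup.comp (h.measurable_workload hV hJ hJF n)) measurableSet_Ioi]
      rfl
    rw [e]
    exact measureReal_mono fun ω hω =>
      lt_of_lt_of_le hω (waitingTime_le hJ hJF _ fun i => hle _ i)
  · filter_upwards [h.nonneg_B 0] with ω hb
    refine ciSup_le fun i => ?_
    rw [workload_one]
    exact nextWorkload_le hJ hJF _ hb _ (hle _) i
  · intro y hy
    rw [← htail y hy]
    refine integral_mono_ae ((hBint.sub h.integrable_A).sub (integrable_const y)).pos_part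
      (hBint.sub (integrable_const y)).pos_part ?_
    filter_upwards [h.nonneg_A 0] with ω ha
    exact max_le_max_right 0 (show orderStat nJ (B 0 ω) - A 0 ω - y ≤ orderStat nJ (B 0 ω) - y by
      linarith)

/-- On `A ≤ L` subtracting `A` costs at most a shift by `L`. This event is independent of sizes and
assignment and contributes the factor `P(A ≤ L)`. -/
theorem integral_mul_tail_le_integral_thinned (hJ : 1 ≤ nJ) (hJF : nJ ≤ nF)
    (h : IsInput P A B S) (hBint : Integrable (fun ω => orderStat nJ (B 0 ω)) P)
    (s : Fin nF ↪ Fin N) (x L : ℝ) :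
    (1 - tail (P.map (A 0)) L) *
        ((∫ ω, max (orderStat nJ (B 0 ω) - (x + L)) 0 ∂P) / thinning N nF nJ)
      ≤ ∫ ω, max ((open Classical in
        if S 0 ω ∈ matchingAssignments (nJ - 1) s (Tuple.sort (B 0 ω))
        then orderStat nJ (B 0 ω) else 0) - A 0 ω - x) 0 ∂P := by
  classical
  have hos := measurable_orderStat hJ hJF
  have hAm := h.measurable_A 0
  have hAp := Measure.isProbabilityMeasure_map hAm.aemeasurable (μ := P)
  have hf : Measurable fun b : Fin nF → ℝ => max (orderStat nJ b - (x + L)) 0 := by fun_prop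
  have hfi : Integrable (fun ω => max (orderStat nJ (B 0 ω) - (x + L)) 0) P :=
    (hBint.sub (integrable_const _)).pos_part
  set g : (Fin nF → ℝ) × (Fin nF ↪ Fin N) → ℝ := fun z =>
    if z.2 ∈ matchingAssignments (nJ - 1) s (Tuple.sort z.1)
    then max (orderStat nJ z.1 - (x + L)) 0 else 0 with hg
  have hgm : Measurable g := measurable_thinned (nJ - 1) s hf
  have hgi : Integrable (fun ω => g (B 0 ω, S 0 ω)) P := integrable_thinned h (nJ - 1) s hf hfi
  have hI : Measurable ((Set.Iic L).indicator fun _ : ℝ => (1 : ℝ)) :=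
    measurable_const.indicator measurableSet_Iic
  have hBS : Measurable fun ω => (B 0 ω, S 0 ω) := (h.measurable_B 0).prodMk (h.measurable_S 0)
  have e1 : ∫ ω, (Set.Iic L).indicator (fun _ => (1 : ℝ)) (A 0 ω) * g (B 0 ω, S 0 ω) ∂P
      = (1 - tail (P.map (A 0)) L) *
        ((∫ ω, max (orderStat nJ (B 0 ω) - (x + L)) 0 ∂P) / thinning N nF nJ) := by
    rw [← integral_thinned hJ hJF h s hf hfi, ← measureReal_Iic, ← smul_eq_mul,
      show (P.map (A 0)).real (Set.Iic L)
        = ∫ ω, (Set.Iic L).indicator (fun _ => (1 : ℝ)) (A 0 ω) ∂P by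
        rw [← integral_map (f := (Set.Iic L).indicator fun _ => (1 : ℝ)) hAm.aemeasurable
          hI.aestronglyMeasurable, integral_indicator_const _ measurableSet_Iic]
        simp]
    exact ((h.indep_A_BS 0).comp hI hgm).integral_fun_mul_eq_mul_integral
      (hI.comp hAm).aestronglyMeasurable (hgm.comp hBS).aestronglyMeasurable
  rw [← e1]
  refine integral_mono_ae (hgi.bdd_mul (c := 1) (hI.comp hAm).aestronglyMeasurable
    (Eventually.of_forall fun ω => ?_))
    (((integrable_thinned h (nJ - 1) s hos hBint).sub h.integrable_A).sub
      (integrable_const x)).pos_part ?_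
  · simp only [Set.indicator_apply]
    split_ifs <;> simp
  filter_upwards [h.nonneg_A 0] with ω ha
  simp only [Set.indicator_apply, Set.mem_Iic, hg, ite_mul, one_mul, zero_mul]
  split_ifs with h1 h2
  · exact max_le_max_right 0 (by linarith)
  · exact le_max_right _ _
  · exact le_max_right _ _
  · exact le_max_right _ _

theorem asymptoticLE_of_forall_shift {μ : Measure ℝ} [IsProbabilityMeasure μ]
    (hμ : ∀ᵐ y ∂μ, 0 ≤ y) (hsub : IsSubexponential μ) {F G : ℝ → ℝ} {c a : ℝ} (hc : 0 < c)
    (ha : 0 < a) (hF : Tendsto F atTop (𝓝 0)) (hG : Tendsto G atTop (𝓝 0))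
    (h : ∀ L x, 0 ≤ L → 0 ≤ x → (1 - F L) * (c * tail μ (x + L)) * (1 - G x) ≤ a * G x) :
    AsymptoticLE (fun x => c / a * tail μ x) G := by
  intro ε hε
  -- Three factors `1 + δ` are lost, through `1 - F L`, `1 - G x` and the shift by `L`; for `δ ≤ 1`
  -- their product is at most `1 + 7 * δ`.
  set δ := min 1 (ε / 7) with hδd
  have hδ : 0 < δ := lt_min one_pos (by positivity)
  have hδ1 : δ ≤ 1 := min_le_left _ _
  have hδε : δ ≤ ε / 7 := min_le_right _ _
  have hlt : (1 + δ)⁻¹ < 1 - 0 := by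
    rw [sub_zero]
    exact inv_lt_one_of_one_lt₀ (by linarith)
  obtain ⟨L, hL0, hL⟩ := ((eventually_ge_atTop 0).and
    ((hF.const_sub 1).eventually_const_lt hlt)).exists
  filter_upwards [eventually_ge_atTop 0, (hG.const_sub 1).eventually_const_lt hlt,
    hsub.eventually_tail_le hμ L hδ] with x hx0 hGx hlong
  have h1 := h L x hL0 hx0
  have hp := hsub.tail_pos (x + L)
  have hGlow : (1 + δ)⁻¹ * (c * tail μ (x + L)) * (1 + δ)⁻¹ ≤ a * G x :=
    le_trans (mul_le_mul (mul_le_mul_of_nonneg_right hL.le (by positivity)) hGx.le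
      (by positivity) (mul_nonneg ((inv_pos.mpr (by linarith)).le.trans hL.le) (by positivity))) h1
  have e : c * tail μ (x + L) ≤ (1 + δ) ^ 2 * (a * G x) := by
    have := mul_le_mul_of_nonneg_left hGlow (show 0 ≤ (1 + δ) ^ 2 by positivity)
    calc c * tail μ (x + L)
        = (1 + δ) ^ 2 * ((1 + δ)⁻¹ * (c * tail μ (x + L)) * (1 + δ)⁻¹) := by field_simp
      _ ≤ _ := this
  have hG0 : 0 ≤ a * G x := le_trans (by positivity) hGlow
  have h3 : (1 + δ) * (1 + δ) ^ 2 ≤ 1 + ε := by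
    have h2 : δ ^ 2 ≤ δ := by nlinarith
    have : δ ^ 3 ≤ δ := (pow_le_of_le_one hδ.le hδ1 three_ne_zero)
    linarith
  have h4 : c * tail μ x ≤ (1 + ε) * (a * G x) :=
    calc c * tail μ x ≤ c * ((1 + δ) * tail μ (x + L)) := by gcongr
      _ = (1 + δ) * (c * tail μ (x + L)) := by ring
      _ ≤ (1 + δ) * ((1 + δ) ^ 2 * (a * G x)) := by gcongr
      _ = ((1 + δ) * (1 + δ) ^ 2) * (a * G x) := by ring
      _ ≤ _ := mul_le_mul_of_nonneg_right h3 hG0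
  rw [div_mul_eq_mul_div, div_le_iff₀ ha]
  linarith

/-- Asymptotic lower bound for the smallest of the workloads at the servers that are not among the
first `nJ - 1` servers of a fixed assignment. -/
theorem asymptoticLE_min_workload (hJ : 1 ≤ nJ) (hJF : nJ ≤ nF) (hFN : nF ≤ N)
    (h : IsInput P A B S) (hs : IsSteadyState P nJ V₀ A B S)
    (hBint : Integrable (fun ω => orderStat nJ (B 0 ω)) P)
    (hB0 : 0 < ∫ ω, orderStat nJ (B 0 ω) ∂P)
    (hBA : ∫ ω, orderStat nJ (B 0 ω) ∂P < ∫ ω, A 0 ω ∂P)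
    {μ : Measure ℝ} [IsProbabilityMeasure μ] (hμ : ∀ᵐ y ∂μ, 0 ≤ y)
    (htail : ∀ y, 0 ≤ y → ∫ ω, max (orderStat nJ (B 0 ω) - y) 0 ∂P
      = (∫ ω, orderStat nJ (B 0 ω) ∂P) * tail μ y)
    (hsub : IsSubexponential μ) (s : Fin nF ↪ Fin N) :
    AsymptoticLE
      (fun x => (∫ ω, orderStat nJ (B 0 ω) ∂P) / thinning N nF nJ /
        (∫ ω, A 0 ω ∂P - (∫ ω, orderStat nJ (B 0 ω) ∂P) / thinning N nF nJ) * tail μ x)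
      (fun x => P.real {ω | x < waitingTime nJ (V₀ ω) s}) := by
  classical
  set K := thinning N nF nJ with hK
  have hK1 : 1 ≤ K := one_le_thinning hJ hJF hFN
  have : Nonempty {l : Fin nF // nJ - 1 ≤ l.val} := ⟨⟨⟨nJ - 1, by omega⟩, le_rfl⟩⟩
  set m : (Fin N → ℝ) → ℝ := fun v => ⨅ l : {l : Fin nF // nJ - 1 ≤ l.val}, v (s l) with hm
  have hmm : Measurable m := Measurable.iInf fun l => measurable_pi_apply _
  have hle : ∀ (v : Fin N → ℝ) (l : Fin nF), nJ - 1 ≤ l.val → m v ≤ v (s l) := fun v l hl =>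
    ciInf_le (Set.finite_range fun l : {l : Fin nF // nJ - 1 ≤ l.val} => v (s l)).bddBelow ⟨l, hl⟩
  have hos := measurable_orderStat hJ hJF
  have hV := hs.measurable_init
  have hBS : Measurable fun ω => (B 0 ω, S 0 ω) := (h.measurable_B 0).prodMk (h.measurable_S 0)
  set T : (Fin nF → ℝ) × (Fin nF ↪ Fin N) → ℝ := fun z =>
    if z.2 ∈ matchingAssignments (nJ - 1) s (Tuple.sort z.1) then orderStat nJ z.1 else 0 with hT
  have hTm : Measurable T := measurable_thinned (nJ - 1) s hos
  have hTi : Integrable (fun ω => T (B 0 ω, S 0 ω)) P := integrable_thinned h (nJ - 1) s hos hBint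
  have hXm : Measurable fun ω => T (B 0 ω, S 0 ω) - A 0 ω :=
    (hTm.comp hBS).sub (h.measurable_A 0)
  have hind := (indepFun_workload_job hJ hJF h hs 0).comp
    (ψ := fun z : ℝ × (Fin nF → ℝ) × (Fin nF ↪ Fin N) => T z.2 - z.1)
    hmm ((hTm.comp measurable_snd).sub measurable_fst)
  have hX : ∫ ω, (T (B 0 ω, S 0 ω) - A 0 ω) ∂P
      = (∫ ω, orderStat nJ (B 0 ω) ∂P) / K - ∫ ω, A 0 ω ∂P := by
    rw [integral_sub hTi h.integrable_A, ← integral_thinned hJ hJF h s hos hBint]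
  have key := fun x => integral_mul_le_tail (P := P) (M := fun ω => m (V₀ ω))
    (X := fun ω => T (B 0 ω, S 0 ω) - A 0 ω) (M' := fun ω => m (workload nJ V₀ A B S 1 ω))
    (hmm.comp hV) hXm (hmm.comp (h.measurable_workload hV hJ hJF 1))
    (by
      filter_upwards [hs.nonneg_init] with ω hω
      exact le_ciInf fun l => hω _)
    hind (hTi.sub h.integrable_A) (hs.map_comp_eq hJ hJF h 1 hmm)
    (Eventually.of_forall fun ω => le_ciInf fun l => by
      rw [workload_one]
      exact le_nextWorkload hJ hJF _ (hle (V₀ ω)) l.2) x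
  have : IsProbabilityMeasure (P.map fun ω => m (V₀ ω)) :=
    Measure.isProbabilityMeasure_map (hmm.comp hV).aemeasurable
  have := Measure.isProbabilityMeasure_map (h.measurable_A 0).aemeasurable (μ := P)
  have hmain := asymptoticLE_of_forall_shift hμ hsub (F := tail (P.map (A 0)))
    (G := tail (P.map fun ω => m (V₀ ω))) (c := (∫ ω, orderStat nJ (B 0 ω) ∂P) / K)
    (a := ∫ ω, A 0 ω ∂P - (∫ ω, orderStat nJ (B 0 ω) ∂P) / K) (by positivity)
    (sub_pos.mpr ((div_le_self hB0.le hK1).trans_lt hBA)) tendsto_tail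
    (tendsto_tail (μ := P.map fun ω => m (V₀ ω))) fun L x hL hx => ?_
  · intro ε hε
    filter_upwards [hmain ε hε] with x hx
    refine hx.trans (mul_le_mul_of_nonneg_left ?_ (by linarith))
    rw [tail, map_measureReal_apply (by exact hmm.comp hV) measurableSet_Ioi]
    exact measureReal_mono fun ω hω =>
      lt_of_lt_of_le hω (le_waitingTime hJ hJF s (hle (V₀ ω)))
  · have h1 := integral_mul_tail_le_integral_thinned hJ hJF h hBint s x L
    have h2 := key x
    rw [htail _ (add_nonneg hx hL)] at h1
    have h3 : 0 ≤ 1 - tail (P.map fun ω => m (V₀ ω)) x := sub_nonneg.mpr (tail_le_one _)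
    have h4 := mul_le_mul_of_nonneg_right h1 h3
    rw [hX] at h2
    have h5 := h4.trans h2
    rw [mul_div_right_comm] at h5
    linarith

/-- The lower half of the theorem, with the residual law described by its tail. -/
theorem asymptoticLE_waitingTime_lower (hJ : 1 ≤ nJ) (hJF : nJ ≤ nF) (hFN : nF ≤ N)
    (h : IsInput P A B S) (hs : IsSteadyState P nJ V₀ A B S)
    (hBint : Integrable (fun ω => orderStat nJ (B 0 ω)) P)
    (hB0 : 0 < ∫ ω, orderStat nJ (B 0 ω) ∂P)
    (hBA : ∫ ω, orderStat nJ (B 0 ω) ∂P < ∫ ω, A 0 ω ∂P)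
    {μ : Measure ℝ} [IsProbabilityMeasure μ] (hμ : ∀ᵐ y ∂μ, 0 ≤ y)
    (htail : ∀ y, 0 ≤ y → ∫ ω, max (orderStat nJ (B 0 ω) - y) 0 ∂P
      = (∫ ω, orderStat nJ (B 0 ω) ∂P) * tail μ y)
    (hsub : IsSubexponential μ) (n : ℕ) :
    AsymptoticLE
      (fun x => (∫ ω, orderStat nJ (B 0 ω) ∂P) / thinning N nF nJ /
        (∫ ω, A 0 ω ∂P - (∫ ω, orderStat nJ (B 0 ω) ∂P) / thinning N nF nJ) * tail μ x)
      (fun x => P.real {ω | x < waitingTime nJ (workload nJ V₀ A B S n ω) (S n ω)}) := by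
  intro ε hε
  have hVn := h.measurable_workload hs.measurable_init hJ hJF n
  have hall := eventually_all.mpr fun s =>
    asymptoticLE_min_workload hJ hJF hFN h hs hBint hB0 hBA hμ htail hsub s ε hε
  filter_upwards [hall] with x hx
  have hE : ∀ s : Fin nF ↪ Fin N, MeasurableSet {v : Fin N → ℝ | x < waitingTime nJ v s} :=
    fun s => measurableSet_lt measurable_const (measurable_waitingTime hJ hJF s)
  have hind : IndepFun (workload nJ V₀ A B S n) (S n) P :=
    (indepFun_workload_job hJ hJF h hs n).comp
      (ψ := fun z : ℝ × (Fin nF → ℝ) × (Fin nF ↪ Fin N) => z.2.2) measurable_id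
      (measurable_snd.comp measurable_snd)
  -- The assignment of job `n` is uniform and independent of the workloads found, so the probability
  -- is an average over `s` of terms with the same lower bound.
  have hpart : P.real {ω | x < waitingTime nJ (workload nJ V₀ A B S n ω) (S n ω)}
      = ∑ s : Fin nF ↪ Fin N, P.real {ω | x < waitingTime nJ (V₀ ω) s} *
        (Fintype.card (Fin nF ↪ Fin N) : ℝ)⁻¹ := by
    have hU : {ω | x < waitingTime nJ (workload nJ V₀ A B S n ω) (S n ω)}
        = ⋃ s, workload nJ V₀ A B S n ⁻¹' {v | x < waitingTime nJ v s} ∩ S n ⁻¹' {s} := by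
      ext ω
      simp
    rw [hU, measureReal_iUnion_fintype]
    · refine Finset.sum_congr rfl fun s _ => ?_
      rw [measureReal_def, hind.measure_inter_preimage_eq_mul _ _ (hE s) (.singleton s),
        ENNReal.toReal_mul]
      congr 1
      · exact hs.measureReal_eq hJ hJF h n (hE s)
      · have := congrArg ENNReal.toReal (h.law_S n s)
        rw [ENNReal.toReal_inv, ENNReal.toReal_natCast] at this
        exact this
    · intro s s' hne
      refine Set.disjoint_left.mpr fun ω h1 h2 => hne ?_
      rw [← (h1.2 : S n ω = s), ← (h2.2 : S n ω = s')]
    · exact fun s => (hVn (hE s)).inter (h.measurable_S n (.singleton s))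
  have : Nonempty (Fin nF ↪ Fin N) := ⟨Fin.castLEEmb hFN⟩
  have hcard : (0 : ℝ) < Fintype.card (Fin nF ↪ Fin N) := Nat.cast_pos.mpr Fintype.card_pos
  rw [hpart, ← Finset.sum_mul, ← div_eq_mul_inv, ← mul_div_assoc, le_div_iff₀ hcard,
    Finset.mul_sum, mul_comm, ← nsmul_eq_mul, ← Finset.card_univ, ← Finset.sum_const]
  exact Finset.sum_le_sum fun s _ => hx s

end Probability

end ForkJoin

/-! ### Main theorem -/

theorem theorem2 {Ω : Type*} [MeasurableSpace Ω] (P : Measure Ω) [IsProbabilityMeasure P]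
    {N nF nJ : ℕ} (hJ : 1 ≤ nJ) (hJF : nJ ≤ nF) (hFN : nF ≤ N)
    (V₀ : Ω → Fin N → ℝ) (A : ℕ → Ω → ℝ) (B : ℕ → Ω → Fin nF → ℝ)
    (S : ℕ → Ω → (Fin nF ↪ Fin N))
    (hinput : ForkJoin.IsInput P A B S)
    (hsteady : ForkJoin.IsSteadyState P nJ V₀ A B S)
    (EA EB ρL ρU : ℝ) (μres : Measure ℝ)
    (hEA : EA = ∫ ω, A 0 ω ∂P)
    (hBint : Integrable (fun ω => ForkJoin.orderStat nJ (B 0 ω)) P)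
    (hEB : EB = ∫ ω, ForkJoin.orderStat nJ (B 0 ω) ∂P)
    (hρL : ρL = EB / (ForkJoin.thinning N nF nJ * EA))
    (hρU : ρU = EB / EA)
    (hμres : μres = ForkJoin.residualLaw (P.map fun ω => ForkJoin.orderStat nJ (B 0 ω)))
    (hstable : ρU < 1)
    (hsub : ForkJoin.IsSubexponential μres) (n : ℕ) :
    ForkJoin.AsymptoticLE (fun x => ρL / (1 - ρL) * ForkJoin.tail μres x)
      (fun x => P.real {ω |
        x < ForkJoin.waitingTime nJ (ForkJoin.workload nJ V₀ A B S n ω) (S n ω)}) ∧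
    ForkJoin.AsymptoticLE
      (fun x => P.real {ω |
        x < ForkJoin.waitingTime nJ (ForkJoin.workload nJ V₀ A B S n ω) (S n ω)})
      (fun x => ρU / (1 - ρU) * ForkJoin.tail μres x) := by
  have hos := ForkJoin.measurable_orderStat hJ hJF
  have hβ : Measurable fun ω => ForkJoin.orderStat nJ (B 0 ω) := hos.comp (hinput.measurable_B 0)
  set ν := P.map fun ω => ForkJoin.orderStat nJ (B 0 ω) with hν
  have := Measure.isProbabilityMeasure_map hβ.aemeasurable (μ := P)
  have hint : Integrable (fun z => z) ν := by
    rwa [integrable_map_measure (by fun_prop) hβ.aemeasurable]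
  have hmean : ∫ z, z ∂ν = EB := by rw [hEB, hν, integral_map hβ.aemeasurable (by fun_prop)]
  have hnn : ∀ᵐ z ∂ν, 0 ≤ z := by
    rw [hν, ae_map_iff hβ.aemeasurable measurableSet_Ici]
    filter_upwards [hinput.nonneg_B 0] with ω hω using ForkJoin.orderStat_nonneg hJ hJF hω
  subst hμres
  have hpos : 0 < ∫ z, z ∂ν := hsub.integral_pos hint hnn
  have := ForkJoin.isProbabilityMeasure_residualLaw hint hnn hpos
  have htail : ∀ y, 0 ≤ y → ∫ ω, max (ForkJoin.orderStat nJ (B 0 ω) - y) 0 ∂P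
      = (∫ ω, ForkJoin.orderStat nJ (B 0 ω) ∂P) * ForkJoin.tail (ForkJoin.residualLaw ν) y := by
    intro y hy
    rw [ForkJoin.tail_residualLaw hint hpos hy, mul_div_assoc', hmean, hEB,
      mul_div_cancel_left₀ _ (by rw [← hEB, ← hmean]; exact hpos.ne'), hν,
      integral_map hβ.aemeasurable (by fun_prop)]
  have hA := hinput.mean_A_pos
  rw [hmean] at hpos
  have hBA : EB < EA := by rwa [hρU, div_lt_one (hEA ▸ hA)] at hstable
  have hEA0 : 0 < EA := hEA ▸ hA
  have hK := ForkJoin.one_le_thinning hJ hJF hFN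
  have hup := ForkJoin.asymptoticLE_waitingTime_upper hJ hJF hFN hinput hsteady hBint
    (hEB ▸ hpos) (hEA ▸ hEB ▸ hBA) ForkJoin.residualLaw_nonneg htail hsub n
  have hlow := ForkJoin.asymptoticLE_waitingTime_lower hJ hJF hFN hinput hsteady hBint
    (hEB ▸ hpos) (hEA ▸ hEB ▸ hBA) ForkJoin.residualLaw_nonneg htail hsub n
  rw [← hEB, ← hEA] at hup hlow
  have hdiff : EA - EB ≠ 0 := (sub_pos.mpr hBA).ne'
  have hEK : EB / ForkJoin.thinning N nF nJ < EA := (div_le_self hpos.le hK).trans_lt hBA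
  have e1 : ρU / (1 - ρU) = EB / (EA - EB) := by
    rw [hρU, one_sub_div hEA0.ne', div_div_div_cancel_right₀ hEA0.ne']
  have e2 : ρL / (1 - ρL)
      = EB / ForkJoin.thinning N nF nJ / (EA - EB / ForkJoin.thinning N nF nJ) := by
    rw [hρL, ← div_div, one_sub_div hEA0.ne', div_div_div_cancel_right₀ hEA0.ne']
  rw [e1, e2]
  exact ⟨hlow, hup⟩
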